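/- Setting. For each $n\ge 1$ consider the change point regression model $y_i=\sum_{j=1}^{N+1}x_i^T\beta^0_{(j-1)}\mathbf 1[\tau^0_{j-1}<w_i\le\tau^0_j]+\varepsilon_i$, $i=1,\dots,n$, where $N\ge 0$, $-\infty=\tau^0_0<\tau^0_1<\dots<\tau^0_N<\tau^0_{N+1}=\infty$, $x_i\in\mathbb R^p$, $w_i,\varepsilon_i\in\mathbb R$; here $p$, $N$, $\tau^0$, $\beta^0$ and all distributions may depend on $n$, and $p\ge n$ for all large $n$. Let $S=\bigcup_{j=0}^{N}\{k:\beta^0_{(j)k}\ne0\}$ and $\xi_{\max}=\max_{1\le j\le N}\|\beta^0_{(j)}-\beta^0_{(j-1)}\|_2$ ($\xi_{\max}=0$ if $N=0$). Assume: (B) $|S|\le s$ for a sequence $s=s_n\ge1$, and $s\log p/(n\,l_{\min}^2)\to0$ for a sequence $0<l_{\min}\le 1$. (D) The $x_i$ are i.i.d. with mean zero and subgaussian with variance parameter at most $C$, i.e. $E\exp(t\,v^Tx_i)\le\exp(Ct^2/2)$ for all $t\in\mathbb R$ and unit vectors $v$, and the eigenvalues of $E x_ix_i^T$ lie in $[\kappa,\phi]$,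 $0<\kappa\le\phi<\infty$; the $\varepsilon_i$ are i.i.d. with mean zero and subgaussian with variance parameter at most $C$; the $w_i$ are i.i.d. with an arbitrary law; and the families $(x_i)_i$, $(w_i)_i$, $(\varepsilon_i)_i$ are mutually independent. The constants $C,\kappa,\phi$ do not depend on $n$. For $\tau_a,\tau_b\in[-\infty,\infty]$ with $\tau_a\le\tau_b$ put $d(\tau_a,\tau_b)=d(\tau_b,\tau_a)=P(\tau_a<w_i\le\tau_b)$ and $n^w(\tau_a,\tau_b)=n^w(\tau_b,\tau_a)=\{i\le n:\tau_a<w_i\le\tau_b\}$. Fix a constant $c_A>0$ and let $$\mathcal A=\{\delta\in\mathbb R^p:\|\delta_{S^c}\|_1\le3\|\delta_S\|_1\},\qquad \mathcal A_2=\{\delta\in\mathbb R^p:\|\delta_{S^c}\|_1\le3\|\delta_S\|_1+c_A\,\xi_{\max}\sqrt s\}.$$ Statement. There are constants $c_0,\dots,c_6>0$ depending only on $\kappa,\phi,C,c_A$ such that for all sequences of models as above and all non-negative sequences $u_n,v_n$ with $\log(u_n^{-1})=O(\log p)$ and $v_n\ge c_0\,s\log p/n$, for all sufficiently large $n$ the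 following three families of inequalities hold simultaneously with probability at least $1-c_1\exp(-c_2\log p)$: (i) for all $\tau_a,\tau_b$ with $d(\tau_a,\tau_b)\ge v_n$ and all $\delta\in\mathcal A$: $\ \frac1n\sum_{i\in n^w(\tau_a,\tau_b)}\delta^Tx_ix_i^T\delta\ge c_3v_n\|\delta\|_2^2$; (ii) for all $\tau_a,\tau_b$ with $d(\tau_a,\tau_b)\ge v_n$ and all $\delta\in\mathcal A_2$: $\ \frac1n\sum_{i\in n^w(\tau_a,\tau_b)}\delta^Tx_ix_i^T\delta\ge c_4v_n\|\delta\|_2^2-c_5\,\xi_{\max}^2\,s\log p/n$; (iii) for all $\tau_a,\tau_b$ with $d(\tau_a,\tau_b)\le u_n$ and all $\delta\in\mathcal A$: $\ \frac1n\sum_{i\in n^w(\tau_a,\tau_b)}\delta^Tx_ix_i^T\delta\le c_6\|\delta\|_2^2\max\{s\log p/n,\,u_n\}$. -/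

import Mathlib

open MeasureTheory ProbabilityTheory Filter Topology Asymptotics
open scoped NNReal

noncomputable section

/-- The data of the change point regression model with sample size `n` and dimension `p`:
`N` finite, distinct change points `τ⁰₁ < ⋯ < τ⁰_N`, regression vectors `β⁰₍₀₎, …, β⁰₍N₎`,
and the random predictors `xᵢ`, change inducing variables `wᵢ` (with common law `wLaw`)
and errors `εᵢ`. -/
structure ChangePointModel (n p : ℕ) (Ω : Type*) [MeasurableSpace Ω] where
  N : ℕ
  τ : Fin N → ℝ
  τ_strictMono : StrictMono τ
  β : Fin (N + 1) → EuclideanSpace ℝ (Fin p)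
  x : Fin n → Ω → EuclideanSpace ℝ (Fin p)
  w : Fin n → Ω → ℝ
  ε : Fin n → Ω → ℝ
  wLaw : Measure ℝ
  measurable_x : ∀ i, Measurable (x i)
  measurable_w : ∀ i, Measurable (w i)
  measurable_ε : ∀ i, Measurable (ε i)

namespace ChangePointModel

variable {n p : ℕ} {Ω : Type*} [MeasurableSpace Ω] (M : ChangePointModel n p Ω)

/-- The extended change points `τ⁰₀ = -∞, τ⁰₁, …, τ⁰_N, τ⁰_{N+1} = ∞`. -/
def knot : Fin (M.N + 2) → EReal :=
  Fin.cons ⊥ (Fin.snoc (fun j => (M.τ j : EReal)) ⊤ : Fin (M.N + 1) → EReal)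

open Classical in
/-- The response `yᵢ = ∑ⱼ xᵢᵀ β⁰₍ⱼ₋₁₎ 1[τ⁰ⱼ₋₁ < wᵢ ≤ τ⁰ⱼ] + εᵢ`. -/
def response (i : Fin n) (ω : Ω) : ℝ :=
  (∑ j : Fin (M.N + 1),
    if M.knot j.castSucc < (M.w i ω : EReal) ∧ (M.w i ω : EReal) ≤ M.knot j.succ
      then inner ℝ (M.x i ω) (M.β j) else 0) + M.ε i ω

open Classical in
/-- `S`, the union of the supports of the regression vectors. -/
def activeSet : Finset (Fin p) :=
  Finset.univ.filter fun k => ∃ j, M.β j k ≠ 0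

/-- The maximum jump size `ξ_max = maxⱼ ‖β⁰₍ⱼ₎ - β⁰₍ⱼ₋₁₎‖₂` (zero if there is no change point). -/
def xiMax : ℝ := ⨆ j : Fin M.N, ‖M.β j.succ - M.β j.castSucc‖

/-- `d(a, b) = P(a < wᵢ ≤ b)` for `a ≤ b`, extended symmetrically. -/
def d (a b : EReal) : ℝ := M.wLaw.real {t : ℝ | (t : EReal) ∈ Set.uIoc a b}

open Classical in
/-- The random index set `n^w(a, b) = {i : a < wᵢ ≤ b}` for `a ≤ b`, extended symmetrically. -/
def nw (a b : EReal) (ω : Ω) : Finset (Fin n) :=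
  Finset.univ.filter fun i => (M.w i ω : EReal) ∈ Set.uIoc a b

/-- `(1/n) ∑_{i ∈ n^w(a,b)} δᵀ xᵢ xᵢᵀ δ`. -/
def partialGram (a b : EReal) (ω : Ω) (δ : EuclideanSpace ℝ (Fin p)) : ℝ :=
  (1 / (n : ℝ)) * ∑ i ∈ M.nw a b ω, (inner ℝ (M.x i ω) δ) ^ 2

/-- The distributional assumptions: `xᵢ` i.i.d. mean zero subgaussian vectors with variance
parameter at most `C` and second moment matrix with eigenvalues in `[κ, φ]`; `εᵢ` i.i.d. mean zero
subgaussian with variance parameter at most `C`; `wᵢ` i.i.d. with law `wLaw`; the families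
`(xᵢ)`, `(wᵢ)`, `(εᵢ)` mutually independent. -/
structure DistributionCondition (P : Measure Ω) (κ φ : ℝ) (C : ℝ≥0) : Prop where
  x_indep : iIndepFun M.x P
  x_ident : ∀ i j, IdentDistrib (M.x i) (M.x j) P P
  x_mean : ∀ i k, ∫ ω, M.x i ω k ∂P = 0
  x_subgaussian : ∀ i, ∀ v : EuclideanSpace ℝ (Fin p), ‖v‖ = 1 →
    HasSubgaussianMGF (fun ω => inner ℝ (M.x i ω) v) C P
  x_cov : ∀ i, spectrum ℝ (Matrix.of fun k l : Fin p => ∫ ω, M.x i ω k * M.x i ω l ∂P)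
    ⊆ Set.Icc κ φ
  ε_indep : iIndepFun M.ε P
  ε_ident : ∀ i j, IdentDistrib (M.ε i) (M.ε j) P P
  ε_mean : ∀ i, ∫ ω, M.ε i ω ∂P = 0
  ε_subgaussian : ∀ i, HasSubgaussianMGF (M.ε i) C P
  w_indep : iIndepFun M.w P
  w_law : ∀ i, P.map (M.w i) = M.wLaw
  indep_x_wε : IndepFun (fun ω i => M.x i ω) (fun ω => (fun i => M.w i ω, fun i => M.ε i ω)) P
  indep_w_ε : IndepFun (fun ω i => M.w i ω) (fun ω i => M.ε i ω) P

end ChangePointModel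

/-- The set `{δ : ‖δ_{Sᶜ}‖₁ ≤ 3 ‖δ_S‖₁ + r}`; it is the cone `𝒜` for `r = 0`, and `𝒜₂` for
`r = c ξ_max √s`. -/
def enlargedCone {p : ℕ} (S : Finset (Fin p)) (r : ℝ) : Set (EuclideanSpace ℝ (Fin p)) :=
  {δ | ∑ k ∈ Sᶜ, |δ k| ≤ 3 * ∑ k ∈ S, |δ k| + r}

end

/-! For a fixed direction and a fixed set `G` of change inducing values, the partial Gram form is an
average of independent terms. Subgaussianity bounds E exp(rY²), where Y = xᵀz for a unit vector z,
and with the eigenvalue bound κ it also bounds E exp(-θY²) away from 1. Chernoff's bound then places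
the form between constant multiples of q‖z‖², q = P(w ∈ G), with failure probability exponentially
small in nq. Three facts make this uniform.

Directions: there are at most p^{2d} sums of d signed basis vectors, so with d of order nq / log p a
union bound covers them all. Maurey's argument (`exists_sum_form_le`, `form_lower_of_signedSum`)
transfers the bounds to every δ at the cost of an error of order (log p / n)‖δ‖₁². It is applied to
the Gram form minus a multiple of the identity, and to the reverse difference.

Cones: there ‖δ‖₁² is at most 32 s‖δ‖² plus a multiple of the squared enlargement, so the error is
absorbed once q is at least a large multiple of s log p / n. The enlargement leaves the additive
term in (ii).

Intervals: every interval is sandwiched between cells with quantile levels in a grid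
(`exists_cells`). The number of pairs of levels is O(p²), against a failure probability of order p⁻³
for each, so the total is O(1/p). Atoms of the law of w are harmless, since the cells are defined
with both closed and open quantiles. -/

noncomputable section

/-! ### Quadratic forms on sums of signed basis vectors -/

/-- The sum of the signed standard basis vectors listed by `g`. -/
def signedSum {p d : ℕ} (g : Fin d → Fin p × Bool) : EuclideanSpace ℝ (Fin p) :=
  ∑ j, (if (g j).2 then (1 : ℝ) else -1) • EuclideanSpace.single (g j).1 (1 : ℝ)

/-- The `ℓ¹` norm of a vector. -/
def l1norm {p : ℕ} (δ : EuclideanSpace ℝ (Fin p)) : ℝ := ∑ k, |δ k|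

lemma l1norm_nonneg {p : ℕ} (δ : EuclideanSpace ℝ (Fin p)) : 0 ≤ l1norm δ :=
  Finset.sum_nonneg fun _ _ => abs_nonneg _

/-- Maurey's empirical method, in a derandomized form: if `m` is a convex combination of the
vectors `y k`, then some sum of `d` of these vectors makes a quadratic form no larger than the
average over independent draws. -/
lemma exists_sum_form_le {E ι : Type*} [AddCommGroup E] [Module ℝ E] [Fintype ι]
    (b : LinearMap.BilinForm ℝ E) (a : ι → ℝ) (ha : ∀ k, 0 ≤ a k) (ha1 : ∑ k, a k = 1)
    (y : ι → E) (d : ℕ) (z : E) :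
    ∃ f : Fin d → ι, b (z + ∑ j, y (f j)) (z + ∑ j, y (f j)) ≤
      b (z + (d : ℝ) • ∑ k, a k • y k) (z + (d : ℝ) • ∑ k, a k • y k)
        + d * (∑ k, a k * b (y k) (y k) - b (∑ k, a k • y k) (∑ k, a k • y k)) := by
  set m := ∑ k, a k • y k with hm
  set V := ∑ k, a k * b (y k) (y k) - b m m with hV
  induction d generalizing z with
  | zero => exact ⟨Fin.elim0, by simp⟩
  | succ d ih =>
    set x := z + (d : ℝ) • m with hx
    -- Some index does at least as well as the average over k with weights `a k`; choosing it
    -- greedily replaces a random draw, and `V` is the variance paid per draw.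
    have hex : ∃ k, b (x + y k) (x + y k) ≤ b (x + m) (x + m) + V := by
      by_contra! hcon
      have havg : ∑ k, a k * b (x + y k) (x + y k) = b (x + m) (x + m) + V := by
        have h1 : ∑ k, a k * b x (y k) = b x m := by simp [hm]
        have h2 : ∑ k, a k * b (y k) x = b m x := by simp [hm]
        have : ∀ k, a k * b (x + y k) (x + y k) =
            a k * b x x + a k * b x (y k) + a k * b (y k) x + a k * b (y k) (y k) := by
          intro k; simp only [map_add, LinearMap.add_apply]; ring
        rw [Finset.sum_congr rfl fun k _ => this k]
        simp only [Finset.sum_add_distrib, h1, h2, ← Finset.sum_mul, ha1, hV, map_add,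
          LinearMap.add_apply]
        ring
      have hlt : ∑ k, a k * (b (x + m) (x + m) + V) < ∑ k, a k * b (x + y k) (x + y k) := by
        apply Finset.sum_lt_sum
        · exact fun k _ => mul_le_mul_of_nonneg_left (hcon k).le (ha k)
        · obtain ⟨k, hk⟩ : ∃ k, a k ≠ 0 := by
            by_contra! h0
            simp [h0] at ha1
          exact ⟨k, Finset.mem_univ _,
            mul_lt_mul_of_pos_left (hcon k) (lt_of_le_of_ne (ha k) hk.symm)⟩
      rw [← Finset.sum_mul, ha1, havg] at hlt
      linarith
    obtain ⟨k, hk⟩ := hex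
    obtain ⟨f, hf⟩ := ih (z + y k)
    refine ⟨Fin.cons k f, ?_⟩
    have e1 : z + ∑ j, y ((Fin.cons k f : Fin (d + 1) → ι) j) = z + y k + ∑ j, y (f j) := by
      rw [Fin.sum_univ_succ]; simp [add_assoc]
    have e2 : z + y k + (d : ℝ) • m = x + y k := by rw [hx]; abel
    have e3 : z + ((d + 1 : ℕ) : ℝ) • m = x + m := by
      rw [hx]; push_cast; rw [add_smul, one_smul]; abel
    rw [e2] at hf
    rw [e1, e3]
    push_cast
    linarith

/-- A quadratic form that is nonnegative on all sums of `d` signed basis vectors is bounded below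
by a multiple of the squared `ℓ¹` norm. -/
lemma form_lower_of_signedSum {p d : ℕ} (hd : 2 ≤ d)
    (b : LinearMap.BilinForm ℝ (EuclideanSpace ℝ (Fin p))) {L : ℝ}
    (hb : ∀ g : Fin d → Fin p × Bool, 0 ≤ b (signedSum g) (signedSum g))
    (hL : ∀ k, b (EuclideanSpace.single k 1) (EuclideanSpace.single k 1) ≤ L)
    (δ : EuclideanSpace ℝ (Fin p)) :
    -(L * l1norm δ ^ 2 / (d - 1)) ≤ b δ δ := by
  have hd1 : (0 : ℝ) < d - 1 := by
    have : (2 : ℝ) ≤ d := by exact_mod_cast hd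
    linarith
  rcases (l1norm_nonneg δ).eq_or_lt with h0 | hpos
  · have hz : δ = 0 := by
      ext k
      have := (Finset.sum_eq_zero_iff_of_nonneg (fun k _ => abs_nonneg (δ k))).1 h0.symm k
        (Finset.mem_univ _)
      simpa using this
    subst hz
    simp [← h0]
  set A := l1norm δ with hA
  -- With weights |δ k| / ‖δ‖₁ on these signed basis vectors the mean is δ / ‖δ‖₁. A zero coordinate
  -- gets sign +1 but weight 0.
  set y : Fin p → EuclideanSpace ℝ (Fin p) := fun k =>
    (if decide (0 ≤ δ k) then (1 : ℝ) else -1) • EuclideanSpace.single k (1 : ℝ) with hy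
  have hyy : ∀ k, b (y k) (y k) ≤ L := by
    intro k
    have : b (y k) (y k) = b (EuclideanSpace.single k 1) (EuclideanSpace.single k 1) := by
      simp only [hy]
      split_ifs <;> simp
    rw [this]
    exact hL k
  have ha1 : ∑ k, |δ k| / A = 1 := by
    rw [← Finset.sum_div]
    exact div_self hpos.ne'
  have hm : ∑ k, (|δ k| / A) • y k = A⁻¹ • δ := by
    ext i
    simp only [hy, WithLp.ofLp_sum, WithLp.ofLp_smul, Finset.sum_apply, Pi.smul_apply,
      EuclideanSpace.single, smul_eq_mul]
    rw [Finset.sum_eq_single i]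
    · by_cases h : 0 ≤ δ i
      · simp [h, abs_of_nonneg h]; ring
      · simp [h, abs_of_neg (not_le.1 h)]; ring
    · intro k _ hk
      simp [hk.symm]
    · simp
  obtain ⟨f, hf⟩ := exists_sum_form_le b (fun k => |δ k| / A)
    (fun k => div_nonneg (abs_nonneg _) hpos.le) ha1 y d 0
  have hnn := hb fun j => (f j, decide (0 ≤ δ (f j)))
  have hsig : signedSum (fun j => (f j, decide (0 ≤ δ (f j)))) = ∑ j, y (f j) := rfl
  rw [hsig] at hnn
  have hV : ∑ k, |δ k| / A * b (y k) (y k) ≤ L := by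
    calc ∑ k, |δ k| / A * b (y k) (y k) ≤ ∑ k, |δ k| / A * L :=
          Finset.sum_le_sum fun k _ =>
            mul_le_mul_of_nonneg_left (hyy k) (div_nonneg (abs_nonneg _) hpos.le)
      _ = L := by rw [← Finset.sum_mul, ha1, one_mul]
  rw [hm] at hf
  simp only [zero_add, map_smul, LinearMap.smul_apply, smul_eq_mul] at hf
  set X := b δ δ
  have hd0 : (0 : ℝ) < d := by linarith
  -- The squared mean enters d² times from the sum and -d times from the variance, hence the factor
  -- d(d - 1).
  have h2 : 0 ≤ (d : ℝ) * ((d - 1) * (A⁻¹ * (A⁻¹ * X)) + L) := by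
    have := mul_le_mul_of_nonneg_left hV hd0.le
    nlinarith
  have h3 : 0 ≤ (d - 1) * (A⁻¹ * (A⁻¹ * X)) + L := nonneg_of_mul_nonneg_right h2 hd0
  have h4 : (d - 1) * (A⁻¹ * (A⁻¹ * X)) + L = (d - 1) / A ^ 2 * (X + L * A ^ 2 / (d - 1)) := by
    field_simp
  rw [h4] at h3
  have := nonneg_of_mul_nonneg_right h3 (by positivity)
  linarith

/-! ### Quantile grids -/

/-- By inner regularity compact subsets suffice, and a nonempty compact set lies between its least
and greatest elements. -/
lemma measureReal_le_of_forall_Icc {μ : Measure ℝ} [IsFiniteMeasure μ] {D : Set ℝ}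
    (hD : MeasurableSet D) {c : ℝ} (hc : 0 ≤ c)
    (h : ∀ x ∈ D, ∀ y ∈ D, x ≤ y → μ.real (Set.Icc x y) ≤ c) : μ.real D ≤ c := by
  refine ENNReal.toReal_le_of_le_ofReal hc ?_
  rw [hD.measure_eq_iSup_isCompact]
  refine iSup₂_le fun K hK => iSup_le fun hKc => ?_
  rcases K.eq_empty_or_nonempty with rfl | hne
  · simp
  obtain ⟨x, hx⟩ := hKc.exists_isLeast hne
  obtain ⟨y, hy⟩ := hKc.exists_isGreatest hne
  have hsub : K ⊆ Set.Icc x y := fun t ht => ⟨hx.2 ht, hy.2 ht⟩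
  refine (measure_mono hsub).trans ?_
  rw [← ENNReal.ofReal_toReal (measure_ne_top μ (Set.Icc x y))]
  exact ENNReal.ofReal_le_ofReal (h x (hK hx.1) y (hK hy.1) (hx.2 hy.1))

/-- The points whose lower quantile level is at least `α` and whose upper level is below `β`,
approximating intervals from inside. -/
def innerCell (μ : Measure ℝ) (α β : ℝ) : Set ℝ :=
  {t | α ≤ μ.real (Set.Iic t)} ∩ {t | μ.real (Set.Iio t) < β}

/-- The points between the quantile levels `α` and `β`, approximating intervals from outside. -/
def outerCell (μ : Measure ℝ) (α β : ℝ) : Set ℝ :=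
  {t | α ≤ μ.real (Set.Iio t)} ∩ {t | μ.real (Set.Iic t) < β}

lemma monotone_measureReal_Iic (μ : Measure ℝ) [IsFiniteMeasure μ] :
    Monotone fun t => μ.real (Set.Iic t) :=
  fun _ _ h => measureReal_mono (Set.Iic_subset_Iic.2 h)

lemma monotone_measureReal_Iio (μ : Measure ℝ) [IsFiniteMeasure μ] :
    Monotone fun t => μ.real (Set.Iio t) :=
  fun _ _ h => measureReal_mono (Set.Iio_subset_Iio h)

lemma measurableSet_innerCell (μ : Measure ℝ) [IsFiniteMeasure μ] (α β : ℝ) :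
    MeasurableSet (innerCell μ α β) :=
  (measurableSet_le measurable_const (monotone_measureReal_Iic μ).measurable).inter
    (measurableSet_lt (monotone_measureReal_Iio μ).measurable measurable_const)

lemma measurableSet_outerCell (μ : Measure ℝ) [IsFiniteMeasure μ] (α β : ℝ) :
    MeasurableSet (outerCell μ α β) :=
  (measurableSet_le measurable_const (monotone_measureReal_Iio μ).measurable).inter
    (measurableSet_lt (monotone_measureReal_Iic μ).measurable measurable_const)

/-- The complement is covered by a lower tail of mass at most α and an upper tail of mass at most 1
- β, whether or not the law has atoms. -/
lemma measureReal_innerCell (μ : Measure ℝ) [IsProbabilityMeasure μ] {α β : ℝ} (hα : 0 ≤ α)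
    (hβ : β ≤ 1) : β - α ≤ μ.real (innerCell μ α β) := by
  have m1 : MeasurableSet {t | μ.real (Set.Iic t) < α} :=
    measurableSet_lt (monotone_measureReal_Iic μ).measurable measurable_const
  have m2 : MeasurableSet {t | β ≤ μ.real (Set.Iio t)} :=
    measurableSet_le measurable_const (monotone_measureReal_Iio μ).measurable
  have h1 : μ.real {t | μ.real (Set.Iic t) < α} ≤ α :=
    measureReal_le_of_forall_Icc m1 hα fun x _ y hy _ =>
      (measureReal_mono (fun t ht => ht.2)).trans (le_of_lt hy)
  have h2 : μ.real {t | β ≤ μ.real (Set.Iio t)} ≤ 1 - β := by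
    refine measureReal_le_of_forall_Icc m2 (by linarith) fun x hx y _ _ => ?_
    have h3 : μ.real (Set.Icc x y) ≤ μ.real (Set.Iio x)ᶜ :=
      measureReal_mono fun t ht => by simpa using ht.1
    rw [probReal_compl_eq_one_sub measurableSet_Iio] at h3
    have : β ≤ μ.real (Set.Iio x) := hx
    linarith
  have h3 : (innerCell μ α β)ᶜ ⊆
      {t | μ.real (Set.Iic t) < α} ∪ {t | β ≤ μ.real (Set.Iio t)} := by
    intro t ht
    simp only [innerCell, Set.mem_compl_iff, Set.mem_inter_iff, Set.mem_ofPred_eq, not_and_or,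
      not_le, not_lt] at ht
    exact ht
  have h4 := (measureReal_mono (μ := μ) h3).trans (measureReal_union_le _ _)
  rw [probReal_compl_eq_one_sub (measurableSet_innerCell μ α β)] at h4
  linarith

lemma measureReal_outerCell (μ : Measure ℝ) [IsProbabilityMeasure μ] {α β : ℝ} (h : α ≤ β) :
    μ.real (outerCell μ α β) ≤ β - α := by
  refine measureReal_le_of_forall_Icc (measurableSet_outerCell μ α β) (by linarith)
    fun x hx y hy hxy => ?_
  have h1 : Set.Icc x y = Set.Iic y \ Set.Iio x := by
    ext t; simp
  have h0 : Set.Iio x ⊆ Set.Iic y := fun t ht => (le_of_lt ht).trans hxy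
  rw [h1, measureReal_sdiff h0 measurableSet_Iio]
  have h2 : α ≤ μ.real (Set.Iio x) := hx.1
  have h3 : μ.real (Set.Iic y) < β := hy.2
  linarith

/-- Every interval contains an inner cell, and is contained in an outer cell, with levels in
`h ℕ` and almost the same probability. -/
lemma exists_cells (μ : Measure ℝ) [IsProbabilityMeasure μ] {h : ℝ} (hh : 0 < h) (a b : EReal) :
    (∃ k l : Fin (⌊1 / h⌋₊ + 2), innerCell μ (k * h) (l * h) ⊆ {t : ℝ | (t : EReal) ∈ Set.uIoc a b} ∧
      μ.real {t : ℝ | (t : EReal) ∈ Set.uIoc a b} ≤ μ.real (innerCell μ (k * h) (l * h)) + 2 * h) ∧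
    (∃ k l : Fin (⌊1 / h⌋₊ + 2), {t : ℝ | (t : EReal) ∈ Set.uIoc a b} ⊆ outerCell μ (k * h) (l * h) ∧
      μ.real (outerCell μ (k * h) (l * h)) ≤ μ.real {t : ℝ | (t : EReal) ∈ Set.uIoc a b} + 2 * h) := by
  wlog hab : a ≤ b generalizing a b
  · rw [Set.uIoc_comm]; exact this b a (le_of_not_ge hab)
  rw [Set.uIoc_of_le hab]
  have mm : ∀ c : EReal, MeasurableSet {t : ℝ | (t : EReal) ≤ c} := fun c =>
    measurable_coe_real_ereal measurableSet_Iic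
  set I := {t : ℝ | (t : EReal) ∈ Set.Ioc a b} with hI
  set α := μ.real {t : ℝ | (t : EReal) ≤ a} with hα
  set β := μ.real {t : ℝ | (t : EReal) ≤ b} with hβ
  have hsub : {t : ℝ | (t : EReal) ≤ a} ⊆ {t : ℝ | (t : EReal) ≤ b} := fun t ht => le_trans ht hab
  have hIm : μ.real I = β - α := by
    rw [hα, hβ, ← measureReal_sdiff hsub (mm a)]
    congr 1
    ext t
    simp [hI, and_comm]
  have hα0 : 0 ≤ α := measureReal_nonneg
  have hβ1 : β ≤ 1 := measureReal_le_one
  have hαβ : α ≤ β := measureReal_mono hsub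
  have hIic : ∀ {t : ℝ} {c : EReal}, (t : EReal) ≤ c →
      μ.real (Set.Iic t) ≤ μ.real {t : ℝ | (t : EReal) ≤ c} := fun ht =>
    measureReal_mono fun r hr => le_trans (EReal.coe_le_coe_iff.2 hr) ht
  have hIio : ∀ {t : ℝ} {c : EReal}, c < (t : EReal) →
      μ.real {t : ℝ | (t : EReal) ≤ c} ≤ μ.real (Set.Iio t) := fun ht =>
    measureReal_mono fun r hr => EReal.coe_lt_coe_iff.1 (lt_of_le_of_lt hr ht)
  have hfl : ∀ c : ℝ, c ≤ 1 → ⌊c / h⌋₊ ≤ ⌊1 / h⌋₊ := fun c hc =>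
    Nat.floor_mono (div_le_div_of_nonneg_right hc hh.le)
  have hlow : ∀ c : ℝ, 0 ≤ c → (⌊c / h⌋₊ : ℝ) * h ≤ c := fun c hc => by
    have := Nat.floor_le (div_nonneg hc hh.le)
    rwa [le_div_iff₀ hh] at this
  have hup : ∀ c : ℝ, c < ((⌊c / h⌋₊ + 1 : ℕ) : ℝ) * h := fun c => by
    have := Nat.lt_floor_add_one (c / h)
    rw [div_lt_iff₀ hh] at this
    exact_mod_cast this
  have hα1 : α ≤ 1 := hαβ.trans hβ1
  have hβ0 : 0 ≤ β := hα0.trans hαβ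
  have ha1 := hlow α hα0
  have ha2 := hup α
  have hb1 := hlow β hβ0
  have hb2 := hup β
  have hfa := hfl α hα1
  have hfb := hfl β hβ1
  have hc1 := measureReal_innerCell μ (α := ((⌊α / h⌋₊ + 1 : ℕ) : ℝ) * h) (β := (⌊β / h⌋₊ : ℝ) * h)
    (by positivity) (hb1.trans hβ1)
  have hmono : (⌊α / h⌋₊ : ℝ) * h ≤ ((⌊β / h⌋₊ + 1 : ℕ) : ℝ) * h := ha1.trans (hαβ.trans hb2.le)
  have hc2 := measureReal_outerCell μ hmono
  constructor
  -- Inner levels round α up and β down, outer levels the reverse, losing at most 2h. Rounding up a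
  -- level near 1 may give index ⌊1/h⌋ + 1, hence the `+ 2` in the index type. The inner levels may
  -- cross, in which case the mass bound is trivial.
  · refine ⟨⟨⌊α / h⌋₊ + 1, by omega⟩, ⟨⌊β / h⌋₊, by omega⟩, ?_, ?_⟩
    · rintro t ⟨ht1, ht2⟩
      simp only [Set.mem_ofPred_eq] at ht1 ht2
      refine ⟨?_, ?_⟩
      · by_contra hcon
        have := hIic (not_lt.1 hcon)
        linarith
      · by_contra hcon
        have := hIio (not_le.1 hcon)
        linarith
    · simp only
      push_cast at *
      linarith
  · refine ⟨⟨⌊α / h⌋₊, by omega⟩, ⟨⌊β / h⌋₊ + 1, by omega⟩, ?_, ?_⟩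
    · rintro t ⟨ht1, ht2⟩
      exact ⟨ha1.trans (hIio ht1), (hIic ht2).trans_lt hb2⟩
    · simp only
      push_cast at *
      linarith

/-! ### Vectors in the cone -/

/-- The cone condition gives ‖δ‖₁ ≤ 4‖δ_S‖₁ + r. Cauchy–Schwarz on S and (a + b)² ≤ 2a² + 2b² give
the constant 32 = 2·4². -/
lemma l1norm_sq_le_of_mem_enlargedCone {p : ℕ} {S : Finset (Fin p)} {r s : ℝ}
    (hS : (S.card : ℝ) ≤ s) {δ : EuclideanSpace ℝ (Fin p)} (hδ : δ ∈ enlargedCone S r) :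
    l1norm δ ^ 2 ≤ 32 * s * ‖δ‖ ^ 2 + 2 * r ^ 2 := by
  have h1 : l1norm δ = ∑ k ∈ S, |δ k| + ∑ k ∈ Sᶜ, |δ k| :=
    (Finset.sum_add_sum_compl S fun k => |δ k|).symm
  have h2 : l1norm δ ≤ 4 * ∑ k ∈ S, |δ k| + r := by
    have : ∑ k ∈ Sᶜ, |δ k| ≤ 3 * ∑ k ∈ S, |δ k| + r := hδ
    linarith
  have h3 : (∑ k ∈ S, |δ k|) ^ 2 ≤ s * ‖δ‖ ^ 2 := by
    have h4 : (∑ k ∈ S, |δ k|) ^ 2 ≤ S.card * ∑ k ∈ S, |δ k| ^ 2 := sq_sum_le_card_mul_sum_sq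
    have h5 : ∑ k ∈ S, |δ k| ^ 2 ≤ ‖δ‖ ^ 2 := by
      rw [EuclideanSpace.norm_sq_eq]
      exact Finset.sum_le_sum_of_subset_of_nonneg (Finset.subset_univ _) fun _ _ _ => by positivity
    exact h4.trans (mul_le_mul hS h5 (by positivity) ((Nat.cast_nonneg _).trans hS))
  have h6 : l1norm δ ^ 2 ≤ (4 * ∑ k ∈ S, |δ k| + r) ^ 2 :=
    pow_le_pow_left₀ (l1norm_nonneg δ) h2 2
  nlinarith [sq_nonneg (4 * ∑ k ∈ S, |δ k| - r)]

/-! ### Exponential moments of squares -/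

universe uΩ

/-- Gaussian linearization: exp(rY²) is the mean of exp(√(2r) Y g) over a standard normal g. After
exchanging integrals, the subgaussian bound in Y leaves exp(Crg²), which is integrable by Fernique's
theorem for small r. -/
lemma exists_lintegral_exp_sq_le (C : ℝ≥0) : ∃ r > (0 : ℝ), ∃ m ≥ (1 : ℝ),
    ∀ (Ω : Type uΩ) [MeasurableSpace Ω] (P : Measure Ω) [IsProbabilityMeasure P] (Y : Ω → ℝ),
      Measurable Y → HasSubgaussianMGF Y C P →
      ∫⁻ ω, ENNReal.ofReal (Real.exp (r * Y ω ^ 2)) ∂P ≤ ENNReal.ofReal m := by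
  obtain ⟨c, hc, hint⟩ := IsGaussian.exists_integrable_exp_sq (gaussianReal 0 1)
  set γ := gaussianReal 0 1
  have hC : (0 : ℝ) < C + 1 := by positivity
  -- This gives C r ≤ c; the `+ 1` keeps `r` defined and positive when C = 0.
  set r := c / (C + 1) with hr
  have hr0 : 0 < r := by positivity
  refine ⟨r, hr0, max 1 (∫ g, Real.exp (c * ‖g‖ ^ 2) ∂γ), le_max_left _ _, ?_⟩
  intro Ω _ P _ Y hY hsub
  have hmgf : ∀ t : ℝ, ENNReal.ofReal (Real.exp (t ^ 2 / 2))
      = ∫⁻ g, ENNReal.ofReal (Real.exp (t * g)) ∂γ := by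
    intro t
    rw [← ofReal_integral_eq_lintegral_ofReal (integrable_exp_mul_gaussianReal t)
      (ae_of_all _ fun _ => (Real.exp_pos _).le)]
    have h := mgf_gaussianReal (p := γ) (X := id) (μ := 0) (v := 1) (by simp [γ]) t
    simp only [mgf, id, zero_mul, zero_add, NNReal.coe_one, one_mul] at h
    rw [h]
  have hsq : Real.sqrt (2 * r) ^ 2 = 2 * r := Real.sq_sqrt (by positivity)
  calc ∫⁻ ω, ENNReal.ofReal (Real.exp (r * Y ω ^ 2)) ∂P
      = ∫⁻ ω, ∫⁻ g, ENNReal.ofReal (Real.exp (Real.sqrt (2 * r) * Y ω * g)) ∂γ ∂P := by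
        refine lintegral_congr fun ω => ?_
        rw [← hmgf, mul_pow, hsq]
        congr 2; ring
    _ = ∫⁻ g, ∫⁻ ω, ENNReal.ofReal (Real.exp (Real.sqrt (2 * r) * Y ω * g)) ∂P ∂γ := by
        refine lintegral_lintegral_swap (Measurable.aemeasurable ?_)
        simp only [Function.uncurry_def]
        fun_prop
    _ ≤ ∫⁻ g, ENNReal.ofReal (Real.exp (c * ‖g‖ ^ 2)) ∂γ := by
        refine lintegral_mono fun g => ?_
        have e : ∀ ω, Real.sqrt (2 * r) * Y ω * g = Real.sqrt (2 * r) * g * Y ω := fun ω => by ring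
        simp only [e]
        rw [← ofReal_integral_eq_lintegral_ofReal (hsub.integrable_exp_mul _)
          (ae_of_all _ fun _ => (Real.exp_pos _).le)]
        refine ENNReal.ofReal_le_ofReal ((hsub.mgf_le _).trans (Real.exp_le_exp.2 ?_))
        rw [mul_pow, hsq, Real.norm_eq_abs, sq_abs]
        have h1 : C * (2 * r * g ^ 2) / 2 = (C * r) * g ^ 2 := by ring
        rw [h1]
        refine mul_le_mul_of_nonneg_right ?_ (sq_nonneg g)
        rw [hr, mul_div_assoc', div_le_iff₀ hC]
        nlinarith
    _ = ENNReal.ofReal (∫ g, Real.exp (c * ‖g‖ ^ 2) ∂γ) :=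
        (ofReal_integral_eq_lintegral_ofReal hint (ae_of_all _ fun _ => (Real.exp_pos _).le)).symm
    _ ≤ _ := ENNReal.ofReal_le_ofReal (le_max_right _ _)

lemma exp_neg_le_one_sub_add_sq {x : ℝ} (hx : 0 ≤ x) : Real.exp (-x) ≤ 1 - x + x ^ 2 := by
  have h1 := Real.add_one_le_exp x
  have h2 : Real.exp (-x) * Real.exp x = 1 := by rw [← Real.exp_add]; simp
  have h3 : Real.exp (-x) * (x + 1) ≤ 1 := by
    calc _ ≤ Real.exp (-x) * Real.exp x := mul_le_mul_of_nonneg_left h1 (Real.exp_pos _).le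
      _ = 1 := h2
  have h4 : 1 ≤ (1 - x + x ^ 2) * (x + 1) := by nlinarith [pow_nonneg hx 3]
  exact le_of_mul_le_mul_right (h3.trans h4) (by linarith)

/-- Second-order expansion of exp(-θY²). The quadratic term is controlled by the exponential moment,
and θ is chosen so that this term costs exactly θκ/2, half of the first-order gain θκ. -/
lemma lintegral_exp_neg_sq_le {Ω : Type*} [MeasurableSpace Ω] {P : Measure Ω}
    [IsProbabilityMeasure P] {Y : Ω → ℝ} (hY : Measurable Y) {r m κ : ℝ} (hr : 0 < r)
    (hm : 1 ≤ m) (hκ : 0 < κ)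
    (hexp : ∫⁻ ω, ENNReal.ofReal (Real.exp (r * Y ω ^ 2)) ∂P ≤ ENNReal.ofReal m)
    (hsq : Integrable (fun ω => Y ω ^ 2) P) (hvar : κ ≤ ∫ ω, Y ω ^ 2 ∂P) :
    ∫⁻ ω, ENNReal.ofReal (Real.exp (-(κ * r ^ 2 / (4 * m)) * Y ω ^ 2)) ∂P ≤
      ENNReal.ofReal (1 - κ * r ^ 2 / (4 * m) * κ / 2) := by
  set θ := κ * r ^ 2 / (4 * m) with hθ
  have hθ0 : 0 < θ := by positivity
  have hint : Integrable (fun ω => Real.exp (r * Y ω ^ 2)) P := by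
    refine ⟨by fun_prop, ?_⟩
    rw [hasFiniteIntegral_iff_ofReal (ae_of_all _ fun _ => (Real.exp_pos _).le)]
    exact hexp.trans_lt ENNReal.ofReal_lt_top
  have hm' : ∫ ω, Real.exp (r * Y ω ^ 2) ∂P ≤ m := by
    rw [← ofReal_integral_eq_lintegral_ofReal hint (ae_of_all _ fun _ => (Real.exp_pos _).le)]
      at hexp
    exact (ENNReal.ofReal_le_ofReal_iff (by linarith)).1 hexp
  have hpt : ∀ ω, Real.exp (-θ * Y ω ^ 2) ≤
      1 - θ * Y ω ^ 2 + 2 * θ ^ 2 / r ^ 2 * Real.exp (r * Y ω ^ 2) := by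
    intro ω
    have h1 := exp_neg_le_one_sub_add_sq (x := θ * Y ω ^ 2) (by positivity)
    have h2 := Real.quadratic_le_exp_of_nonneg (x := r * Y ω ^ 2) (by positivity)
    have h3 : (r * Y ω ^ 2) ^ 2 ≤ 2 * Real.exp (r * Y ω ^ 2) := by
      have : 0 ≤ r * Y ω ^ 2 := by positivity
      linarith
    have h4 : (θ * Y ω ^ 2) ^ 2 = θ ^ 2 / r ^ 2 * (r * Y ω ^ 2) ^ 2 := by
      field_simp
    have h5 : θ ^ 2 / r ^ 2 * (r * Y ω ^ 2) ^ 2 ≤ θ ^ 2 / r ^ 2 * (2 * Real.exp (r * Y ω ^ 2)) :=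
      mul_le_mul_of_nonneg_left h3 (by positivity)
    rw [neg_mul]
    calc _ ≤ _ := h1
      _ ≤ 1 - θ * Y ω ^ 2 + θ ^ 2 / r ^ 2 * (2 * Real.exp (r * Y ω ^ 2)) := by rw [h4]; linarith
      _ = _ := by ring
  have hi1 : Integrable (fun ω => 1 - θ * Y ω ^ 2) P :=
    (integrable_const 1).sub (hsq.const_mul θ)
  have hi2 := hint.const_mul (2 * θ ^ 2 / r ^ 2)
  have hi3 : Integrable (fun ω => Real.exp (-θ * Y ω ^ 2)) P := by
    refine Integrable.mono' (hi1.add hi2) (by fun_prop) (ae_of_all _ fun ω => ?_)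
    rw [Real.norm_eq_abs, Real.abs_exp]
    exact hpt ω
  rw [← ofReal_integral_eq_lintegral_ofReal hi3 (ae_of_all _ fun _ => (Real.exp_pos _).le)]
  refine ENNReal.ofReal_le_ofReal ((integral_mono hi3 (hi1.add hi2) hpt).trans ?_)
  have e : ∫ ω, (1 - θ * Y ω ^ 2 + 2 * θ ^ 2 / r ^ 2 * Real.exp (r * Y ω ^ 2)) ∂P
      = 1 - θ * ∫ ω, Y ω ^ 2 ∂P + 2 * θ ^ 2 / r ^ 2 * ∫ ω, Real.exp (r * Y ω ^ 2) ∂P := by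
    rw [integral_add hi1 hi2, integral_sub (integrable_const 1) (hsq.const_mul θ),
      integral_const_mul, integral_const_mul]
    simp
  have h6 : 2 * θ ^ 2 / r ^ 2 * ∫ ω, Real.exp (r * Y ω ^ 2) ∂P ≤ 2 * θ ^ 2 / r ^ 2 * m :=
    mul_le_mul_of_nonneg_left hm' (by positivity)
  have h7 : 2 * θ ^ 2 / r ^ 2 * m = θ * κ / 2 := by
    rw [hθ]; field_simp; ring
  have h8 : θ * κ ≤ θ * ∫ ω, Y ω ^ 2 ∂P := mul_le_mul_of_nonneg_left hvar hθ0.le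
  simp only [Pi.add_apply]
  rw [e]
  linarith

/-! ### Gram forms over a fixed set of change inducing values -/

namespace ChangePointModel

variable {n p : ℕ} {Ω : Type uΩ} [MeasurableSpace Ω] (M : ChangePointModel n p Ω)

open Classical in
/-- `(1/n) ∑ᵢ 1[wᵢ ∈ G] (xᵢᵀ δ)²`. -/
def cellGram (G : Set ℝ) (ω : Ω) (δ : EuclideanSpace ℝ (Fin p)) : ℝ :=
  (1 / (n : ℝ)) * ∑ i, if M.w i ω ∈ G then (inner ℝ (M.x i ω) δ) ^ 2 else 0

lemma cellGram_smul (G : Set ℝ) (ω : Ω) (c : ℝ) (δ : EuclideanSpace ℝ (Fin p)) :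
    M.cellGram G ω (c • δ) = c ^ 2 * M.cellGram G ω δ := by
  simp only [cellGram, inner_smul_right, mul_pow, Finset.mul_sum]
  refine Finset.sum_congr rfl fun i _ => ?_
  split_ifs
  · ring
  · simp

lemma cellGram_nonneg (G : Set ℝ) (ω : Ω) (δ : EuclideanSpace ℝ (Fin p)) :
    0 ≤ M.cellGram G ω δ :=
  mul_nonneg (by positivity) (Finset.sum_nonneg fun i _ => by split_ifs <;> positivity)

lemma partialGram_eq_cellGram (a b : EReal) (ω : Ω) (δ : EuclideanSpace ℝ (Fin p)) :
    M.partialGram a b ω δ = M.cellGram {t : ℝ | (t : EReal) ∈ Set.uIoc a b} ω δ := by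
  classical
  simp only [partialGram, cellGram, nw, Finset.sum_filter]
  congr 2 with i

lemma cellGram_mono {G H : Set ℝ} (h : G ⊆ H) (ω : Ω) (δ : EuclideanSpace ℝ (Fin p)) :
    M.cellGram G ω δ ≤ M.cellGram H ω δ := by
  refine mul_le_mul_of_nonneg_left (Finset.sum_le_sum fun i _ => ?_) (by positivity)
  by_cases h1 : M.w i ω ∈ G
  · simp [h1, h h1]
  · by_cases h2 : M.w i ω ∈ H <;> simp [h1, h2, sq_nonneg]

lemma measurable_inner_x (i : Fin n) (δ : EuclideanSpace ℝ (Fin p)) :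
    Measurable fun ω => (inner ℝ (M.x i ω) δ : ℝ) :=
  (M.measurable_x i).inner_const

lemma measurable_cellGram {G : Set ℝ} (hG : MeasurableSet G) (δ : EuclideanSpace ℝ (Fin p)) :
    Measurable fun ω => M.cellGram G ω δ := by
  classical
  unfold cellGram
  refine Measurable.const_mul (Finset.measurable_sum _ fun i _ => ?_) _
  exact Measurable.ite (M.measurable_w i hG) ((M.measurable_inner_x i δ).pow_const 2)
    measurable_const

/-- The bilinear form of `cellGram`. -/
def cellForm (G : Set ℝ) (ω : Ω) : LinearMap.BilinForm ℝ (EuclideanSpace ℝ (Fin p)) :=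
  open Classical in
  (1 / (n : ℝ)) • ∑ i, (if M.w i ω ∈ G then (1 : ℝ) else 0) •
    (LinearMap.mul ℝ ℝ).compl₁₂ (innerₗ _ (M.x i ω)) (innerₗ _ (M.x i ω))

lemma cellForm_self (G : Set ℝ) (ω : Ω) (δ : EuclideanSpace ℝ (Fin p)) :
    M.cellForm G ω δ δ = M.cellGram G ω δ := by
  simp only [cellForm, cellGram, LinearMap.smul_apply, LinearMap.sum_apply, smul_eq_mul,
    LinearMap.compl₁₂_apply, LinearMap.mul_apply', innerₗ_apply_apply]
  congr 2 with i
  split_ifs <;> simp [sq]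

variable {M} {P : Measure Ω} {κ φ : ℝ} {C : ℝ≥0}

/-- The second moment matrix minus κ times the identity is symmetric with nonnegative spectrum,
hence positive semidefinite. -/
lemma DistributionCondition.integral_inner_sq_ge (hM : M.DistributionCondition P κ φ C) (i : Fin n)
    {z : EuclideanSpace ℝ (Fin p)} (hz : ‖z‖ = 1) :
    κ ≤ ∫ ω, (inner ℝ (M.x i ω) z : ℝ) ^ 2 ∂P := by
  set A := Matrix.of fun k l : Fin p => ∫ ω, M.x i ω k * M.x i ω l ∂P with hA
  have hL2 : ∀ k, MemLp (fun ω => M.x i ω k) 2 P := by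
    intro k
    have h := (hM.x_subgaussian i (EuclideanSpace.single k 1) (by simp)).memLp 2
    simpa [EuclideanSpace.inner_single_right] using h
  have hint : ∀ k l, Integrable (fun ω => M.x i ω k * M.x i ω l) P := fun k l =>
    (hL2 k).integrable_mul (hL2 l)
  have hherm : A.IsHermitian := by
    ext k l
    simp [hA, mul_comm]
  have hpsd : (A - algebraMap ℝ _ κ).PosSemidef := by
    rw [Matrix.posSemidef_iff_isHermitian_and_spectrum_nonneg]
    refine ⟨hherm.sub ?_, ?_⟩
    · rw [Matrix.algebraMap_eq_diagonal]
      exact Matrix.isHermitian_diagonal _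
    · intro a ha
      rw [← spectrum.sub_singleton_eq] at ha
      obtain ⟨b, hb, c, hc, rfl⟩ := ha
      have := (hM.x_cov i hb).1
      rw [Set.mem_singleton_iff] at hc
      simpa [hc] using this
  have h1 := hpsd.dotProduct_mulVec_nonneg (WithLp.ofLp z)
  have hzz : ∑ k, z k * z k = 1 := by
    have := EuclideanSpace.real_norm_sq_eq z
    rw [hz] at this
    simp only [sq] at this
    linarith
  have h2 : ∫ ω, (inner ℝ (M.x i ω) z : ℝ) ^ 2 ∂P = ∑ k, ∑ l, z k * (A k l * z l) := by
    have : ∀ ω, (inner ℝ (M.x i ω) z : ℝ) ^ 2 =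
        ∑ k, ∑ l, (z k * z l) * (M.x i ω k * M.x i ω l) := by
      intro ω
      rw [PiLp.inner_apply, sq, Finset.sum_mul_sum]
      refine Finset.sum_congr rfl fun k _ => Finset.sum_congr rfl fun l _ => ?_
      simp only [RCLike.inner_apply, conj_trivial]
      ring
    simp only [this]
    rw [integral_finsetSum _ fun k _ => integrable_finsetSum _ fun l _ => (hint k l).const_mul _]
    refine Finset.sum_congr rfl fun k _ => ?_
    rw [integral_finsetSum _ fun l _ => (hint k l).const_mul _]
    refine Finset.sum_congr rfl fun l _ => ?_
    rw [integral_const_mul]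
    simp only [hA, Matrix.of_apply]
    ring
  rw [h2]
  rw [Algebra.algebraMap_eq_smul_one, star_trivial, Matrix.sub_mulVec, Matrix.smul_mulVec,
    Matrix.one_mulVec, dotProduct_sub, dotProduct_smul] at h1
  simp only [dotProduct, Matrix.mulVec, Finset.mul_sum, smul_eq_mul, hzz, mul_one] at h1
  linarith

lemma DistributionCondition.isProbabilityMeasure_wLaw [IsProbabilityMeasure P] (hM : M.DistributionCondition P κ φ C)
    (hn : 0 < n) : IsProbabilityMeasure M.wLaw := by
  rw [← hM.w_law ⟨0, hn⟩]
  exact Measure.isProbabilityMeasure_map (M.measurable_w _).aemeasurable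

/-- Exponential moments of `cellGram` factorize. -/
lemma DistributionCondition.lintegral_exp_cellGram_le [IsProbabilityMeasure P] (hM : M.DistributionCondition P κ φ C)
    (hn : 0 < n) {G : Set ℝ} (hG : MeasurableSet G) (z : EuclideanSpace ℝ (Fin p)) {σ m : ℝ}
    (hm : 0 ≤ m)
    (hexp : ∀ i, ∫⁻ ω, ENNReal.ofReal (Real.exp (σ * (inner ℝ (M.x i ω) z : ℝ) ^ 2)) ∂P
      ≤ ENNReal.ofReal m) :
    ∫⁻ ω, ENNReal.ofReal (Real.exp (σ * n * M.cellGram G ω z)) ∂P ≤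
      ENNReal.ofReal (Real.exp (n * M.wLaw.real G * (m - 1))) := by
  classical
  have hn' : (n : ℝ) ≠ 0 := by positivity
  have := hM.isProbabilityMeasure_wLaw hn
  set q := M.wLaw.real G with hq
  let X : Ω → Fin n → EuclideanSpace ℝ (Fin p) := fun ω i => M.x i ω
  let W : Ω → Fin n → ℝ := fun ω i => M.w i ω
  have hX : Measurable X := measurable_pi_lambda _ M.measurable_x
  have hW : Measurable W := measurable_pi_lambda _ M.measurable_w
  have hind : IndepFun W X P := by
    have := hM.indep_x_wε.comp measurable_id (measurable_fst (α := Fin n → ℝ) (β := Fin n → ℝ))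
    exact this.symm
  have hlaw := (indepFun_iff_map_prod_eq_prod_map_map hW.aemeasurable hX.aemeasurable).1 hind
  let F : Fin n → ℝ → EuclideanSpace ℝ (Fin p) → ENNReal := fun i w x =>
    if w ∈ G then ENNReal.ofReal (Real.exp (σ * (inner ℝ x z : ℝ) ^ 2)) else 1
  have hF : ∀ i, Measurable (Function.uncurry (F i)) := fun i => by
    refine Measurable.ite (measurable_fst hG) ?_ measurable_const
    fun_prop
  let Φ : (Fin n → ℝ) × (Fin n → EuclideanSpace ℝ (Fin p)) → ENNReal := fun u =>
    ∏ i, F i (u.1 i) (u.2 i)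
  have hΦ : Measurable Φ := by
    refine Finset.measurable_fun_prod _ fun i _ => ?_
    have h : Measurable fun u : (Fin n → ℝ) × (Fin n → EuclideanSpace ℝ (Fin p)) =>
        (u.1 i, u.2 i) := by fun_prop
    exact (hF i).comp h
  have hpt : ∀ ω, ENNReal.ofReal (Real.exp (σ * n * M.cellGram G ω z)) = Φ (W ω, X ω) := by
    intro ω
    have : σ * n * M.cellGram G ω z =
        ∑ i, if M.w i ω ∈ G then σ * (inner ℝ (M.x i ω) z : ℝ) ^ 2 else 0 := by
      rw [cellGram, mul_assoc, ← mul_assoc (n : ℝ), mul_one_div_cancel hn', one_mul,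
        Finset.mul_sum]
      refine Finset.sum_congr rfl fun i _ => ?_
      split_ifs <;> simp
    rw [this, Real.exp_sum, ENNReal.ofReal_prod_of_nonneg fun _ _ => (Real.exp_pos _).le]
    refine Finset.prod_congr rfl fun i _ => ?_
    simp only [F, W, X]
    split_ifs <;> simp
  simp only [hpt]
  -- Freezing w leaves a product over independent xᵢ, in which only indices with wᵢ ∈ G contribute a
  -- factor `m`.
  have hinner : ∀ w : Fin n → ℝ, ∫⁻ x, Φ (w, x) ∂(P.map X) ≤
      ∏ i, if w i ∈ G then ENNReal.ofReal m else 1 := by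
    intro w
    rw [lintegral_map (f := fun x => Φ (w, x)) (hΦ.comp measurable_prodMk_left) hX]
    have hi : iIndepFun (fun i ω => F i (w i) (M.x i ω)) P :=
      hM.x_indep.comp (fun i => F i (w i)) fun i => (hF i).comp measurable_prodMk_left
    simp only [Φ, X]
    rw [lintegral_prod_eq_prod_lintegral_of_indepFun _ _ hi fun i =>
      ((hF i).comp measurable_prodMk_left).comp (M.measurable_x i)]
    refine Finset.prod_le_prod' fun i _ => ?_
    simp only [F]
    split_ifs
    · exact hexp i
    · simp
  have hH : Measurable fun w : ℝ => if w ∈ G then ENNReal.ofReal m else 1 :=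
    Measurable.ite hG measurable_const measurable_const
  have hone : ∀ i, ∫⁻ ω, (if M.w i ω ∈ G then ENNReal.ofReal m else 1) ∂P ≤
      ENNReal.ofReal (Real.exp (q * (m - 1))) := by
    intro i
    rw [← lintegral_map (μ := P) (f := fun w : ℝ => if w ∈ G then ENNReal.ofReal m else 1) hH
      (M.measurable_w i), hM.w_law i]
    have e : (fun w : ℝ => if w ∈ G then ENNReal.ofReal m else 1) =
        fun w => G.indicator (fun _ => ENNReal.ofReal m) w + Gᶜ.indicator (fun _ => 1) w := by
      ext w
      by_cases h : w ∈ G <;> simp [h]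
    rw [e, lintegral_add_left (measurable_const.indicator hG), lintegral_indicator_const hG,
      lintegral_indicator_const hG.compl, ← ENNReal.ofReal_toReal (measure_ne_top M.wLaw G),
      ← ENNReal.ofReal_toReal (measure_ne_top M.wLaw Gᶜ), one_mul, ← ENNReal.ofReal_mul hm,
      ← ENNReal.ofReal_add (by positivity) (by positivity)]
    refine ENNReal.ofReal_le_ofReal ?_
    have h1 : (M.wLaw Gᶜ).toReal = 1 - q := probReal_compl_eq_one_sub hG
    have h2 : (M.wLaw G).toReal = q := rfl
    rw [h1, h2]
    -- Each factor has mean 1 + q(m - 1) ≤ exp(q(m - 1)).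
    have := Real.add_one_le_exp (q * (m - 1))
    linarith
  calc ∫⁻ ω, Φ (W ω, X ω) ∂P = ∫⁻ u, Φ u ∂((P.map W).prod (P.map X)) := by
        rw [← hlaw, lintegral_map hΦ (hW.prodMk hX)]
    _ = ∫⁻ w, ∫⁻ x, Φ (w, x) ∂(P.map X) ∂(P.map W) := lintegral_prod _ hΦ.aemeasurable
    _ ≤ ∫⁻ w, ∏ i, (if w i ∈ G then ENNReal.ofReal m else 1) ∂(P.map W) := lintegral_mono hinner
    _ = ∫⁻ ω, ∏ i, (if M.w i ω ∈ G then ENNReal.ofReal m else 1) ∂P := by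
        rw [lintegral_map (f := fun w : Fin n → ℝ =>
          ∏ i, (if w i ∈ G then ENNReal.ofReal m else 1)) (Finset.measurable_fun_prod _ fun i _ =>
          hH.comp (measurable_pi_apply i)) hW]
    _ = ∏ i, ∫⁻ ω, (if M.w i ω ∈ G then ENNReal.ofReal m else 1) ∂P :=
        lintegral_prod_eq_prod_lintegral_of_indepFun _
          (fun i ω => if M.w i ω ∈ G then ENNReal.ofReal m else 1)
          (hM.w_indep.comp (fun _ w => if w ∈ G then ENNReal.ofReal m else 1) fun _ => hH)
          fun i => hH.comp (M.measurable_w i)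
    _ ≤ ∏ _i : Fin n, ENNReal.ofReal (Real.exp (q * (m - 1))) :=
        Finset.prod_le_prod' fun i _ => hone i
    _ = _ := by
        rw [Finset.prod_const, Finset.card_univ, Fintype.card_fin,
          ← ENNReal.ofReal_pow (Real.exp_pos _).le, ← Real.exp_nat_mul]
        congr 2; ring

end ChangePointModel

/-! ### Union bounds -/

lemma measureReal_le_exp_of_lintegral_exp_le {Ω : Type*} [MeasurableSpace Ω] {P : Measure Ω}
    {Z : Ω → ℝ} (hZ : Measurable Z) {B T : ℝ}
    (h : ∫⁻ ω, ENNReal.ofReal (Real.exp (Z ω)) ∂P ≤ ENNReal.ofReal (Real.exp B)) {A : Set Ω}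
    (hA : ∀ ω ∈ A, T ≤ Z ω) : P.real A ≤ Real.exp (B - T) := by
  refine ENNReal.toReal_le_of_le_ofReal (Real.exp_pos _).le ?_
  have h1 : A ⊆ {ω | ENNReal.ofReal (Real.exp T) ≤ ENNReal.ofReal (Real.exp (Z ω))} := fun ω hω =>
    ENNReal.ofReal_le_ofReal (Real.exp_le_exp.2 (hA ω hω))
  refine (measure_mono h1).trans ((meas_ge_le_lintegral_div (by fun_prop)
    (by simpa using Real.exp_pos T) ENNReal.ofReal_ne_top).trans ?_)
  rw [Real.exp_sub, ENNReal.ofReal_div_of_pos (Real.exp_pos _)]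
  exact ENNReal.div_le_div_right h _

lemma exists_event_forall {Ω ι : Type*} [MeasurableSpace Ω] {P : Measure Ω}
    [IsProbabilityMeasure P] [Fintype ι] {c : ℝ} {A : ι → Ω → Prop}
    (h : ∀ i, ∃ E : Set Ω, MeasurableSet E ∧ P.real Eᶜ ≤ c ∧ ∀ ω ∈ E, A i ω) :
    ∃ E : Set Ω, MeasurableSet E ∧ P.real Eᶜ ≤ Fintype.card ι * c ∧ ∀ ω ∈ E, ∀ i, A i ω := by
  choose E hE hc hA using h
  refine ⟨⋂ i, E i, MeasurableSet.iInter hE, ?_, fun ω hω i => hA i ω (Set.mem_iInter.1 hω i)⟩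
  rw [Set.compl_iInter]
  calc P.real (⋃ i, (E i)ᶜ) ≤ ∑ i, P.real (E i)ᶜ := measureReal_iUnion_fintype_le _
    _ ≤ ∑ _i : ι, c := Finset.sum_le_sum fun i _ => hc i
    _ = _ := by simp

lemma exists_event_and {Ω : Type*} [MeasurableSpace Ω] {P : Measure Ω}
    [IsProbabilityMeasure P] {c₁ c₂ : ℝ} {A₁ A₂ : Ω → Prop}
    (h₁ : ∃ E : Set Ω, MeasurableSet E ∧ P.real Eᶜ ≤ c₁ ∧ ∀ ω ∈ E, A₁ ω)
    (h₂ : ∃ E : Set Ω, MeasurableSet E ∧ P.real Eᶜ ≤ c₂ ∧ ∀ ω ∈ E, A₂ ω) :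
    ∃ E : Set Ω, MeasurableSet E ∧ P.real Eᶜ ≤ c₁ + c₂ ∧ ∀ ω ∈ E, A₁ ω ∧ A₂ ω := by
  obtain ⟨E, hE, hc, hA⟩ := h₁
  obtain ⟨F, hF, hd, hB⟩ := h₂
  refine ⟨E ∩ F, hE.inter hF, ?_, fun ω hω => ⟨hA ω hω.1, hB ω hω.2⟩⟩
  rw [Set.compl_inter]
  exact (measureReal_union_le _ _).trans (add_le_add hc hd)

/-- There are (2p)^d signed lists, at most p^{2d} because p ≥ 2. -/
lemma exists_event_signedSum {Ω : Type*} [MeasurableSpace Ω] {P : Measure Ω}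
    [IsProbabilityMeasure P] {p : ℕ} (hp : 2 ≤ p) (d : ℕ) {x : ℝ}
    {A : EuclideanSpace ℝ (Fin p) → Ω → Prop}
    (h : ∀ z, ∃ E : Set Ω, MeasurableSet E ∧ P.real Eᶜ ≤ Real.exp (-x) ∧ ∀ ω ∈ E, A z ω) :
    ∃ E : Set Ω, MeasurableSet E ∧ P.real Eᶜ ≤ Real.exp (2 * d * Real.log p - x) ∧
      ∀ ω ∈ E, ∀ g : Fin d → Fin p × Bool, A (signedSum g) ω := by
  obtain ⟨E, hE, hc, hA⟩ := exists_event_forall fun g : Fin d → Fin p × Bool => h (signedSum g)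
  refine ⟨E, hE, hc.trans ?_, hA⟩
  have hp0 : (0 : ℝ) < p := by positivity
  have h1 : (Fintype.card (Fin d → Fin p × Bool) : ℝ) ≤ Real.exp (2 * d * Real.log p) := by
    have h2 : Real.exp (2 * d * Real.log p) = ((p : ℝ) * p) ^ d := by
      rw [← Real.exp_log hp0, ← Real.exp_add, ← Real.exp_nat_mul, Real.exp_log hp0]
      congr 1; ring
    rw [h2]
    have h3 : p * 2 ≤ p * p := Nat.mul_le_mul_left p hp
    simp only [Fintype.card_fun, Fintype.card_prod, Fintype.card_fin, Fintype.card_bool]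
    exact_mod_cast Nat.pow_le_pow_left h3 d
  rw [sub_eq_add_neg, Real.exp_add]
  exact mul_le_mul_of_nonneg_right h1 (Real.exp_pos _).le

namespace ChangePointModel

variable {n p : ℕ} {Ω : Type uΩ} [MeasurableSpace Ω] {M : ChangePointModel n p Ω}
  {P : Measure Ω} {κ φ : ℝ} {C : ℝ≥0}

/-! ### Concentration over a fixed set -/

lemma cellGram_eq_normalize (G : Set ℝ) (ω : Ω) {z : EuclideanSpace ℝ (Fin p)} (hz : z ≠ 0) :
    M.cellGram G ω z = ‖z‖ ^ 2 * M.cellGram G ω ((‖z‖)⁻¹ • z) := by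
  rw [cellGram_smul, ← mul_assoc, ← mul_pow, mul_inv_cancel₀ (norm_ne_zero_iff.2 hz), one_pow,
    one_mul]

lemma DistributionCondition.exists_event_cellGram_le [IsProbabilityMeasure P]
    (hM : M.DistributionCondition P κ φ C) (hn : 0 < n) {G : Set ℝ} (hG : MeasurableSet G)
    {r m t : ℝ} (hr : 0 < r) (hm : 1 ≤ m)
    (hexp : ∀ i, ∀ z : EuclideanSpace ℝ (Fin p), ‖z‖ = 1 →
      ∫⁻ ω, ENNReal.ofReal (Real.exp (r * (inner ℝ (M.x i ω) z : ℝ) ^ 2)) ∂P ≤ ENNReal.ofReal m)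
    (ht : M.wLaw.real G ≤ t) (z : EuclideanSpace ℝ (Fin p)) :
    ∃ E : Set Ω, MeasurableSet E ∧ P.real Eᶜ ≤ Real.exp (-(n * t)) ∧
      ∀ ω ∈ E, M.cellGram G ω z ≤ m / r * t * ‖z‖ ^ 2 := by
  refine ⟨{ω | M.cellGram G ω z ≤ m / r * t * ‖z‖ ^ 2},
    measurableSet_le (M.measurable_cellGram hG z) measurable_const, ?_, fun ω hω => hω⟩
  rcases eq_or_ne z 0 with rfl | hz
  · simp [cellGram, (Real.exp_pos _).le]
  have hz0 : 0 < ‖z‖ := norm_pos_iff.2 hz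
  set y := (‖z‖)⁻¹ • z with hy
  have hy1 : ‖y‖ = 1 := by simp [hy, norm_smul, hz0.ne']
  have h := hM.lintegral_exp_cellGram_le hn hG y (by linarith) fun i => hexp i y hy1
  -- Chernoff with exponent nt(m - 1) against threshold mnt leaves -nt.
  refine (measureReal_le_exp_of_lintegral_exp_le (T := m * n * t)
    ((M.measurable_cellGram hG y).const_mul _) h fun ω hω => ?_).trans (Real.exp_le_exp.2 ?_)
  · simp only [Set.mem_compl_iff, Set.mem_ofPred_eq, not_le] at hω
    rw [M.cellGram_eq_normalize G ω hz, mul_comm (‖z‖ ^ 2)] at hω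
    have h1 := lt_of_mul_lt_mul_right hω (by positivity)
    calc m * n * t = r * n * (m / r * t) := by field_simp
      _ ≤ _ := mul_le_mul_of_nonneg_left h1.le (by positivity)
  · have : n * M.wLaw.real G * (m - 1) ≤ n * t * (m - 1) :=
      mul_le_mul_of_nonneg_right (mul_le_mul_of_nonneg_left ht (by positivity)) (by linarith)
    linarith

lemma DistributionCondition.exists_event_le_cellGram [IsProbabilityMeasure P]
    (hM : M.DistributionCondition P κ φ C) (hn : 0 < n) {G : Set ℝ} (hG : MeasurableSet G)
    {θ : ℝ} (hθ : 0 < θ) (hθκ : θ * κ / 2 ≤ 1)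
    (hexp : ∀ i, ∀ z : EuclideanSpace ℝ (Fin p), ‖z‖ = 1 →
      ∫⁻ ω, ENNReal.ofReal (Real.exp (-θ * (inner ℝ (M.x i ω) z : ℝ) ^ 2)) ∂P ≤
        ENNReal.ofReal (1 - θ * κ / 2))
    (z : EuclideanSpace ℝ (Fin p)) :
    ∃ E : Set Ω, MeasurableSet E ∧ P.real Eᶜ ≤ Real.exp (-(θ * κ / 4 * (n * M.wLaw.real G))) ∧
      ∀ ω ∈ E, κ / 4 * M.wLaw.real G * ‖z‖ ^ 2 ≤ M.cellGram G ω z := by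
  refine ⟨{ω | κ / 4 * M.wLaw.real G * ‖z‖ ^ 2 ≤ M.cellGram G ω z},
    measurableSet_le measurable_const (M.measurable_cellGram hG z), ?_, fun ω hω => hω⟩
  rcases eq_or_ne z 0 with rfl | hz
  · simp [cellGram, (Real.exp_pos _).le]
  have hz0 : 0 < ‖z‖ := norm_pos_iff.2 hz
  set y := (‖z‖)⁻¹ • z with hy
  have hy1 : ‖y‖ = 1 := by simp [hy, norm_smul, hz0.ne']
  have h := hM.lintegral_exp_cellGram_le hn hG y (by linarith) fun i => hexp i y hy1
  -- The exponent -θκnq/2 meets the threshold -θκnq/4, so half of it survives.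
  refine (measureReal_le_exp_of_lintegral_exp_le (T := -(θ * κ / 4 * (n * M.wLaw.real G)))
    ((M.measurable_cellGram hG y).const_mul _) h fun ω hω => ?_).trans
    (Real.exp_le_exp.2 (by ring_nf; exact le_rfl))
  simp only [Set.mem_compl_iff, Set.mem_ofPred_eq, not_le] at hω
  rw [M.cellGram_eq_normalize G ω hz, mul_comm (‖z‖ ^ 2)] at hω
  have h1 := lt_of_mul_lt_mul_right hω (by positivity)
  have h2 : θ * n * M.cellGram G ω y ≤ θ * n * (κ / 4 * M.wLaw.real G) :=
    mul_le_mul_of_nonneg_left h1.le (by positivity)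
  linarith

/-! ### Bounds over a fixed set for all vectors -/

lemma exists_nat_between {x : ℝ} (hx : 4 ≤ x) :
    ∃ d : ℕ, 2 ≤ d ∧ (d : ℝ) ≤ x ∧ x / 2 ≤ (d : ℝ) - 1 := by
  refine ⟨⌊x⌋₊, Nat.le_floor (by norm_num; linarith), Nat.floor_le (by linarith), ?_⟩
  have := Nat.lt_floor_add_one x
  linarith

/-- The length d ≈ ρnt / (4 log p) keeps the entropy 2d log p below ρnt/2, while the Maurey error,
of order t‖δ‖₁²/d, becomes a multiple of (log p / n)‖δ‖₁² in which t cancels. -/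
lemma DistributionCondition.exists_event_forall_cellGram_le [IsProbabilityMeasure P]
    (hM : M.DistributionCondition P κ φ C) (hn : 0 < n) (hp : 2 ≤ p) {G : Set ℝ}
    (hG : MeasurableSet G) {r m t ρ : ℝ} (hr : 0 < r) (hm : 1 ≤ m) (hρ : 0 < ρ) (hρ1 : ρ ≤ 1)
    (hexp : ∀ i, ∀ z : EuclideanSpace ℝ (Fin p), ‖z‖ = 1 →
      ∫⁻ ω, ENNReal.ofReal (Real.exp (r * (inner ℝ (M.x i ω) z : ℝ) ^ 2)) ∂P ≤ ENNReal.ofReal m)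
    (ht : M.wLaw.real G ≤ t) (hnt : 16 * Real.log p ≤ ρ * (n * t)) :
    ∃ E : Set Ω, MeasurableSet E ∧ P.real Eᶜ ≤ Real.exp (-(ρ * (n * t) / 2)) ∧
      ∀ ω ∈ E, (∀ k, M.cellGram G ω (EuclideanSpace.single k 1) ≤ m / r * t) ∧
        ∀ δ, M.cellGram G ω δ ≤
          m / r * t * ‖δ‖ ^ 2 + 8 * (m / r) / ρ * (Real.log p / n) * l1norm δ ^ 2 := by
  have hlog : 0 < Real.log p := Real.log_pos (by exact_mod_cast hp)
  have hn' : (0 : ℝ) < n := by exact_mod_cast hn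
  have ht0 : 0 < t := by
    have : 0 < ρ * (n * t) := by linarith
    exact pos_of_mul_pos_right (pos_of_mul_pos_right this hρ.le) hn'.le
  obtain ⟨d, hd2, hdx, hxd⟩ := exists_nat_between (x := ρ * (n * t) / (4 * Real.log p))
    (by rw [le_div_iff₀ (by positivity)]; linarith)
  obtain ⟨E, hE, hEP, hEA⟩ := exists_event_signedSum hp d fun z =>
    hM.exists_event_cellGram_le hn hG hr hm hexp ht z
  have hd0 : (0 : ℝ) < d := by positivity
  refine ⟨E, hE, hEP.trans (Real.exp_le_exp.2 ?_), fun ω hω => ?_⟩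
  · rw [le_div_iff₀ (by positivity)] at hdx
    have : ρ * (n * t) ≤ 1 * (n * t) := mul_le_mul_of_nonneg_right hρ1 (by positivity)
    linarith
  have hK : 0 < m / r := by positivity
  have hsingle : ∀ k, M.cellGram G ω (EuclideanSpace.single k 1) ≤ m / r * t := by
    intro k
    -- A constant list sums to d times a basis vector, so the diagonal bound needed by Maurey comes
    -- from the same event.
    have h := hEA ω hω fun _ => (k, true)
    have e : signedSum (fun _ : Fin d => (k, true)) = (d : ℝ) • EuclideanSpace.single k 1 := by
      simp [signedSum, ← Nat.cast_smul_eq_nsmul ℝ]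
    rw [e, cellGram_smul, norm_smul] at h
    simp only [Real.norm_natCast, PiLp.norm_single, norm_one, mul_one] at h
    rw [mul_comm] at h
    exact le_of_mul_le_mul_right h (by positivity)
  refine ⟨hsingle, fun δ => ?_⟩
  have hform := form_lower_of_signedSum hd2 (L := m / r * t)
    ((m / r * t) • innerₗ (EuclideanSpace ℝ (Fin p)) - M.cellForm G ω)
    (fun g => by
      have := hEA ω hω g
      simp only [LinearMap.sub_apply, LinearMap.smul_apply, innerₗ_apply_apply, smul_eq_mul,
        real_inner_self_eq_norm_sq, cellForm_self]
      linarith)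
    (fun k => by
      have := M.cellGram_nonneg G ω (EuclideanSpace.single k 1)
      simp only [LinearMap.sub_apply, LinearMap.smul_apply, innerₗ_apply_apply, smul_eq_mul,
        real_inner_self_eq_norm_sq, cellForm_self, PiLp.norm_single, norm_one]
      linarith) δ
  simp only [LinearMap.sub_apply, LinearMap.smul_apply, innerₗ_apply_apply, smul_eq_mul,
    real_inner_self_eq_norm_sq, cellForm_self] at hform
  have h1 : m / r * t * l1norm δ ^ 2 / (d - 1) ≤
      m / r * t * l1norm δ ^ 2 / (ρ * (n * t) / (4 * Real.log p) / 2) :=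
    div_le_div_of_nonneg_left (by positivity) (by positivity) hxd
  have h2 : m / r * t * l1norm δ ^ 2 / (ρ * (n * t) / (4 * Real.log p) / 2) =
      8 * (m / r) / ρ * (Real.log p / n) * l1norm δ ^ 2 := by
    field_simp; ring
  linarith

/-- The lower bound also needs the upper event: it bounds the diagonal of the Gram form, which
controls the Maurey error. -/
lemma DistributionCondition.exists_event_forall_le_cellGram [IsProbabilityMeasure P]
    (hM : M.DistributionCondition P κ φ C) (hκ : 0 < κ) (hn : 0 < n) (hp : 2 ≤ p) {G : Set ℝ}
    (hG : MeasurableSet G) {r m θ ρ : ℝ} (hr : 0 < r) (hm : 1 ≤ m) (hρ : 0 < ρ) (hρ1 : ρ ≤ 1)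
    (hθ : 0 < θ) (hθκ : θ * κ / 2 ≤ 1) (hρθ : ρ ≤ θ * κ / 4)
    (hexp : ∀ i, ∀ z : EuclideanSpace ℝ (Fin p), ‖z‖ = 1 →
      ∫⁻ ω, ENNReal.ofReal (Real.exp (r * (inner ℝ (M.x i ω) z : ℝ) ^ 2)) ∂P ≤ ENNReal.ofReal m)
    (hexp' : ∀ i, ∀ z : EuclideanSpace ℝ (Fin p), ‖z‖ = 1 →
      ∫⁻ ω, ENNReal.ofReal (Real.exp (-θ * (inner ℝ (M.x i ω) z : ℝ) ^ 2)) ∂P ≤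
        ENNReal.ofReal (1 - θ * κ / 2))
    (hnt : 16 * Real.log p ≤ ρ * (n * M.wLaw.real G)) :
    ∃ E : Set Ω, MeasurableSet E ∧ P.real Eᶜ ≤ 2 * Real.exp (-(ρ * (n * M.wLaw.real G) / 2)) ∧
      ∀ ω ∈ E, ∀ δ, κ / 4 * M.wLaw.real G * ‖δ‖ ^ 2 -
        8 * (m / r) / ρ * (Real.log p / n) * l1norm δ ^ 2 ≤ M.cellGram G ω δ := by
  set q := M.wLaw.real G with hq
  have hlog : 0 < Real.log p := Real.log_pos (by exact_mod_cast hp)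
  have hn' : (0 : ℝ) < n := by exact_mod_cast hn
  have hq0 : 0 < q := by
    have : 0 < ρ * (n * q) := by linarith
    exact pos_of_mul_pos_right (pos_of_mul_pos_right this hρ.le) hn'.le
  obtain ⟨d, hd2, hdx, hxd⟩ := exists_nat_between (x := ρ * (n * q) / (4 * Real.log p))
    (by rw [le_div_iff₀ (by positivity)]; linarith)
  obtain ⟨E, hE, hEP, hEA⟩ := exists_event_and
    (hM.exists_event_forall_cellGram_le hn hp hG hr hm hρ hρ1 hexp le_rfl hnt)
    (exists_event_signedSum hp d fun z => hM.exists_event_le_cellGram hn hG hθ hθκ hexp' z)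
  refine ⟨E, hE, hEP.trans ?_, fun ω hω δ => ?_⟩
  · have : Real.exp (2 * d * Real.log p - θ * κ / 4 * (n * q)) ≤
        Real.exp (-(ρ * (n * q) / 2)) := by
      refine Real.exp_le_exp.2 ?_
      rw [le_div_iff₀ (by positivity)] at hdx
      have : ρ * (n * q) ≤ θ * κ / 4 * (n * q) := mul_le_mul_of_nonneg_right hρθ (by positivity)
      linarith
    linarith
  have hK : 0 < m / r := by positivity
  have hform := form_lower_of_signedSum hd2 (L := m / r * q)
    (M.cellForm G ω - (κ / 4 * q) • innerₗ (EuclideanSpace ℝ (Fin p)))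
    (fun g => by
      have := (hEA ω hω).2 g
      simp only [LinearMap.sub_apply, LinearMap.smul_apply, innerₗ_apply_apply, smul_eq_mul,
        real_inner_self_eq_norm_sq, cellForm_self]
      linarith)
    (fun k => by
      have := (hEA ω hω).1.1 k
      have h0 : 0 ≤ κ / 4 * q := by positivity
      simp only [LinearMap.sub_apply, LinearMap.smul_apply, innerₗ_apply_apply, smul_eq_mul,
        real_inner_self_eq_norm_sq, cellForm_self, PiLp.norm_single, norm_one]
      linarith) δ
  simp only [LinearMap.sub_apply, LinearMap.smul_apply, innerₗ_apply_apply, smul_eq_mul,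
    real_inner_self_eq_norm_sq, cellForm_self] at hform
  have h1 : m / r * q * l1norm δ ^ 2 / (d - 1) ≤
      m / r * q * l1norm δ ^ 2 / (ρ * (n * q) / (4 * Real.log p) / 2) :=
    div_le_div_of_nonneg_left (by positivity) (by positivity) hxd
  have h2 : m / r * q * l1norm δ ^ 2 / (ρ * (n * q) / (4 * Real.log p) / 2) =
      8 * (m / r) / ρ * (Real.log p / n) * l1norm δ ^ 2 := by
    field_simp; ring
  linarith

/-! ### Uniformity over intervals -/

/-- A union bound over all pairs of grid levels at distance of order `x`. -/
lemma exists_event_forall_levels [IsProbabilityMeasure P] (hp : 2 ≤ p) {ρ x : ℝ}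
    (hx : 0 < x) (hxp : 1 / x ≤ p) (hnx : 3 * Real.log p ≤ ρ * (n * x) / 4)
    {A : ℝ → ℝ → Ω → Prop}
    (h : ∀ α β, ∃ E : Set Ω, MeasurableSet E ∧ P.real Eᶜ ≤ 2 * Real.exp (-(ρ * (n * x) / 4)) ∧
      ∀ ω ∈ E, A α β ω) :
    ∃ E : Set Ω, MeasurableSet E ∧ P.real Eᶜ ≤ 50 * Real.exp (-Real.log p) ∧
      ∀ ω ∈ E, ∀ k l : Fin (⌊1 / (x / 4)⌋₊ + 2), A (k * (x / 4)) (l * (x / 4)) ω := by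
  obtain ⟨E, hE, hEP, hEA⟩ := exists_event_forall
    fun i : Fin (⌊1 / (x / 4)⌋₊ + 2) × Fin (⌊1 / (x / 4)⌋₊ + 2) =>
      h (i.1 * (x / 4)) (i.2 * (x / 4))
  refine ⟨E, hE, hEP.trans ?_, fun ω hω k l => hEA ω hω (k, l)⟩
  have hp' : (2 : ℝ) ≤ p := by exact_mod_cast hp
  have hcard : ((⌊1 / (x / 4)⌋₊ : ℝ) + 2) ≤ 5 * p := by
    have h1 := Nat.floor_le (a := 1 / (x / 4)) (by positivity)
    have h2 : 1 / (x / 4) = 4 * (1 / x) := by field_simp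
    linarith
  have hexp : Real.exp (-(ρ * (n * x) / 4)) ≤ ((p : ℝ) ^ 3)⁻¹ := by
    have : ((p : ℝ) ^ 3)⁻¹ = Real.exp (-(3 * Real.log p)) := by
      rw [Real.exp_neg, ← Real.log_rpow (by positivity), Real.exp_log (by positivity)]
      norm_cast
    rw [this]
    exact Real.exp_le_exp.2 (by linarith)
  rw [Real.exp_neg (Real.log p), Real.exp_log (by positivity)]
  simp only [Fintype.card_prod, Fintype.card_fin]
  push_cast
  -- At most 25p² pairs of levels, each failing with probability at most 2p⁻³.
  calc ((⌊1 / (x / 4)⌋₊ : ℝ) + 2) * (⌊1 / (x / 4)⌋₊ + 2) * (2 * Real.exp (-(ρ * (n * x) / 4)))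
      ≤ (5 * p) * (5 * p) * (2 * ((p : ℝ) ^ 3)⁻¹) := by gcongr
    _ = 50 * (p : ℝ)⁻¹ := by field_simp; norm_num

lemma one_div_le_of_rate {n p : ℕ} {c s x : ℝ} (hn : 2 ≤ n) (hnp : n ≤ p) (hc : 2 ≤ c)
    (hs : 1 ≤ s) (hx : c * (s * Real.log p / n) ≤ x) :
    0 < x ∧ 1 / x ≤ p ∧ c * Real.log p ≤ n * x := by
  have hn' : (0 : ℝ) < n := by positivity
  have hp2 : (2 : ℝ) ≤ p := by exact_mod_cast hn.trans hnp
  have hlog : 1 / 2 ≤ Real.log p := by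
    have h1 := Real.log_two_gt_d9
    have h2 := Real.log_le_log (by norm_num) hp2
    linarith
  have h1 : c * Real.log p ≤ n * x := by
    have h2 : n * (c * (s * Real.log p / n)) ≤ n * x := mul_le_mul_of_nonneg_left hx hn'.le
    have h3 : n * (c * (s * Real.log p / n)) = s * (c * Real.log p) := by field_simp
    have h4 : 1 * (c * Real.log p) ≤ s * (c * Real.log p) :=
      mul_le_mul_of_nonneg_right hs (by positivity)
    linarith
  have h2 : 1 ≤ n * x := by nlinarith
  have hx0 : 0 < x := pos_of_mul_pos_right (by linarith) hn'.le
  refine ⟨hx0, ?_, h1⟩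
  rw [div_le_iff₀ hx0]
  have : (n : ℝ) ≤ p := by exact_mod_cast hnp
  exact h2.trans (mul_le_mul_of_nonneg_right this hx0.le)

lemma DistributionCondition.exists_event_le_partialGram [IsProbabilityMeasure P]
    (hM : M.DistributionCondition P κ φ C) (hκ : 0 < κ) (hn : 2 ≤ n) (hnp : n ≤ p)
    {r m θ ρ : ℝ} (hr : 0 < r) (hm : 1 ≤ m) (hρ : 0 < ρ) (hρ1 : ρ ≤ 1)
    (hθ : 0 < θ) (hθκ : θ * κ / 2 ≤ 1) (hρθ : ρ ≤ θ * κ / 4)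
    (hexp : ∀ i, ∀ z : EuclideanSpace ℝ (Fin p), ‖z‖ = 1 →
      ∫⁻ ω, ENNReal.ofReal (Real.exp (r * (inner ℝ (M.x i ω) z : ℝ) ^ 2)) ∂P ≤ ENNReal.ofReal m)
    (hexp' : ∀ i, ∀ z : EuclideanSpace ℝ (Fin p), ‖z‖ = 1 →
      ∫⁻ ω, ENNReal.ofReal (Real.exp (-θ * (inner ℝ (M.x i ω) z : ℝ) ^ 2)) ∂P ≤
        ENNReal.ofReal (1 - θ * κ / 2))
    {s v c : ℝ} (hs : 1 ≤ s) (hS : (M.activeSet.card : ℝ) ≤ s) (hc : 32 / ρ ≤ c)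
    (hc' : 512 * (8 * (m / r) / ρ) / κ ≤ c) (hv : c * (s * Real.log p / n) ≤ v) :
    ∃ E : Set Ω, MeasurableSet E ∧ P.real Eᶜ ≤ 50 * Real.exp (-Real.log p) ∧
      ∀ ω ∈ E, ∀ a b : EReal, v ≤ M.d a b → ∀ ξ : ℝ, ∀ δ ∈ enlargedCone M.activeSet ξ,
        κ / 16 * v * ‖δ‖ ^ 2 - 2 * (8 * (m / r) / ρ) * (Real.log p / n) * ξ ^ 2 ≤
          M.partialGram a b ω δ := by
  have hn0 : 0 < n := by omega
  have hp : 2 ≤ p := hn.trans hnp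
  have hlog : 0 < Real.log p := Real.log_pos (by exact_mod_cast hp)
  have := hM.isProbabilityMeasure_wLaw hn0
  have h32 : 32 ≤ c * ρ := by rwa [div_le_iff₀ hρ] at hc
  have hc2 : 2 ≤ c := by nlinarith
  obtain ⟨hv0, hvp, hnv⟩ := one_div_le_of_rate hn hnp hc2 hs hv
  have hρv : 32 * Real.log p ≤ ρ * (n * v) := by
    have h1 := mul_le_mul_of_nonneg_left hnv hρ.le
    have h2 := mul_le_mul_of_nonneg_right h32 hlog.le
    linarith
  set K := 8 * (m / r) / ρ with hK
  have hK0 : 0 < K := by positivity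
  -- Cells of mass below v/2 satisfy the implication vacuously. A cell inscribed in an interval of
  -- mass at least v is never of this kind, since the grid step v/4 loses at most v/2.
  have hcell : ∀ α β, ∃ E : Set Ω, MeasurableSet E ∧
      P.real Eᶜ ≤ 2 * Real.exp (-(ρ * (n * v) / 4)) ∧
      ∀ ω ∈ E, v / 2 ≤ M.wLaw.real (innerCell M.wLaw α β) → ∀ δ,
        κ / 4 * M.wLaw.real (innerCell M.wLaw α β) * ‖δ‖ ^ 2 -
          K * (Real.log p / n) * l1norm δ ^ 2 ≤ M.cellGram (innerCell M.wLaw α β) ω δ := by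
    intro α β
    by_cases hq : v / 2 ≤ M.wLaw.real (innerCell M.wLaw α β)
    · have hnq : ρ * (n * v) / 2 ≤ ρ * (n * M.wLaw.real (innerCell M.wLaw α β)) := by
        calc ρ * (n * v) / 2 = ρ * (n * (v / 2)) := by ring
          _ ≤ _ := by gcongr
      obtain ⟨E, hE, hEP, hEA⟩ := hM.exists_event_forall_le_cellGram hκ hn0 hp
        (measurableSet_innerCell M.wLaw α β) hr hm hρ hρ1 hθ hθκ hρθ hexp hexp' (by linarith)
      refine ⟨E, hE, hEP.trans ?_, fun ω hω _ => hEA ω hω⟩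
      have h1 : Real.exp (-(ρ * (n * M.wLaw.real (innerCell M.wLaw α β)) / 2)) ≤
          Real.exp (-(ρ * (n * v) / 4)) := Real.exp_le_exp.2 (by linarith)
      linarith
    · exact ⟨Set.univ, MeasurableSet.univ, by simp; positivity, fun ω _ h => absurd h hq⟩
  obtain ⟨E, hE, hEP, hEA⟩ := exists_event_forall_levels hp hv0 hvp (by linarith) hcell
  refine ⟨E, hE, hEP, fun ω hω a b hab ξ δ hδ => ?_⟩
  obtain ⟨⟨k, l, hsub, hmass⟩, -⟩ := exists_cells M.wLaw (h := v / 4) (by linarith) a b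
  have hab' : v ≤ M.wLaw.real {t : ℝ | (t : EReal) ∈ Set.uIoc a b} := hab
  set G := innerCell M.wLaw (k * (v / 4)) (l * (v / 4))
  set q := M.wLaw.real G
  have hq : v / 2 ≤ q := by linarith
  have h1 := hEA ω hω k l hq δ
  have h2 : M.cellGram G ω δ ≤ M.partialGram a b ω δ := by
    rw [partialGram_eq_cellGram]; exact M.cellGram_mono hsub ω δ
  have h3 := l1norm_sq_le_of_mem_enlargedCone hS hδ
  have hn' : (0 : ℝ) < n := by exact_mod_cast hn0
  have h4 : K * (Real.log p / n) * l1norm δ ^ 2 ≤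
      K * (Real.log p / n) * (32 * s * ‖δ‖ ^ 2 + 2 * ξ ^ 2) :=
    mul_le_mul_of_nonneg_left h3 (by positivity)
  -- The cone error uses up half of the curvature κq/4; the remaining κq/8 is at least κv/16 because
  -- q ≥ v/2.
  have h5 : 32 * K * (s * Real.log p / n) ≤ κ / 8 * q := by
    have h6 : 512 * K ≤ c * κ := by rwa [div_le_iff₀ hκ] at hc'
    have h7 : 512 * K * (s * Real.log p / n) ≤ c * κ * (s * Real.log p / n) :=
      mul_le_mul_of_nonneg_right h6 (by positivity)
    have h8 : κ * (c * (s * Real.log p / n)) ≤ κ * v := mul_le_mul_of_nonneg_left hv hκ.le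
    have h9 : κ * (v / 2) ≤ κ * q := mul_le_mul_of_nonneg_left hq hκ.le
    linarith
  have h6 := mul_le_mul_of_nonneg_right h5 (sq_nonneg ‖δ‖)
  have h7 : κ / 16 * v * ‖δ‖ ^ 2 ≤ κ / 8 * q * ‖δ‖ ^ 2 :=
    mul_le_mul_of_nonneg_right (by nlinarith) (sq_nonneg ‖δ‖)
  have h8 : K * (Real.log p / n) * (32 * s * ‖δ‖ ^ 2 + 2 * ξ ^ 2) =
      32 * K * (s * Real.log p / n) * ‖δ‖ ^ 2 + 2 * K * (Real.log p / n) * ξ ^ 2 := by ring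
  linarith

lemma DistributionCondition.exists_event_partialGram_le [IsProbabilityMeasure P]
    (hM : M.DistributionCondition P κ φ C) (hn : 2 ≤ n) (hnp : n ≤ p)
    {r m ρ : ℝ} (hr : 0 < r) (hm : 1 ≤ m) (hρ : 0 < ρ) (hρ1 : ρ ≤ 1)
    (hexp : ∀ i, ∀ z : EuclideanSpace ℝ (Fin p), ‖z‖ = 1 →
      ∫⁻ ω, ENNReal.ofReal (Real.exp (r * (inner ℝ (M.x i ω) z : ℝ) ^ 2)) ∂P ≤ ENNReal.ofReal m)
    {s u c : ℝ} (hs : 1 ≤ s) (hS : (M.activeSet.card : ℝ) ≤ s) (hc : 32 / ρ ≤ c) :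
    ∃ E : Set Ω, MeasurableSet E ∧ P.real Eᶜ ≤ 50 * Real.exp (-Real.log p) ∧
      ∀ ω ∈ E, ∀ a b : EReal, M.d a b ≤ u → ∀ δ ∈ enlargedCone M.activeSet 0,
        M.partialGram a b ω δ ≤ (2 * (m / r) * c + 32 * (8 * (m / r) / ρ)) * ‖δ‖ ^ 2 *
          max (s * Real.log p / n) u := by
  have hn0 : 0 < n := by omega
  have hn' : (0 : ℝ) < n := by exact_mod_cast hn0
  have hp : 2 ≤ p := hn.trans hnp
  have hlog : 0 < Real.log p := Real.log_pos (by exact_mod_cast hp)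
  have := hM.isProbabilityMeasure_wLaw hn0
  have h32 : 32 ≤ c * ρ := by rwa [div_le_iff₀ hρ] at hc
  have hc2 : 2 ≤ c := by nlinarith
  set K := 8 * (m / r) / ρ with hK
  have hK0 : 0 < K := by positivity
  set R := max (s * Real.log p / n) u with hR
  have hR0 : 0 < R := lt_of_lt_of_le (by positivity) (le_max_left _ _)
  -- As `u` may be arbitrarily small, the grid is built at the scale `v`, which is at least `u` and
  -- large enough for concentration. Outer cells then have mass at most u + v/2 ≤ 2v.
  set v := c * R with hvdef
  have hv : c * (s * Real.log p / n) ≤ v :=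
    mul_le_mul_of_nonneg_left (le_max_left _ _) (by linarith)
  have huv : u ≤ v := by
    have : u ≤ R := le_max_right _ _
    nlinarith
  obtain ⟨hv0, hvp, hnv⟩ := one_div_le_of_rate hn hnp hc2 hs hv
  have hρv : 32 * Real.log p ≤ ρ * (n * v) := by
    have h1 := mul_le_mul_of_nonneg_left hnv hρ.le
    have h2 := mul_le_mul_of_nonneg_right h32 hlog.le
    linarith
  have hcell : ∀ α β, ∃ E : Set Ω, MeasurableSet E ∧
      P.real Eᶜ ≤ 2 * Real.exp (-(ρ * (n * v) / 4)) ∧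
      ∀ ω ∈ E, M.wLaw.real (outerCell M.wLaw α β) ≤ 2 * v → ∀ δ,
        M.cellGram (outerCell M.wLaw α β) ω δ ≤ m / r * (2 * v) * ‖δ‖ ^ 2 +
          K * (Real.log p / n) * l1norm δ ^ 2 := by
    intro α β
    by_cases hq : M.wLaw.real (outerCell M.wLaw α β) ≤ 2 * v
    · obtain ⟨E, hE, hEP, hEA⟩ := hM.exists_event_forall_cellGram_le hn0 hp
        (measurableSet_outerCell M.wLaw α β) hr hm hρ hρ1 hexp hq (by linarith)
      refine ⟨E, hE, hEP.trans ?_, fun ω hω _ => (hEA ω hω).2⟩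
      have h1 : Real.exp (-(ρ * (n * (2 * v)) / 2)) ≤ Real.exp (-(ρ * (n * v) / 4)) :=
        Real.exp_le_exp.2 (by linarith)
      have h2 := Real.exp_pos (-(ρ * (n * v) / 4))
      linarith
    · exact ⟨Set.univ, MeasurableSet.univ, by simp; positivity, fun ω _ h => absurd h hq⟩
  obtain ⟨E, hE, hEP, hEA⟩ := exists_event_forall_levels hp hv0 hvp (by linarith) hcell
  refine ⟨E, hE, hEP, fun ω hω a b hab δ hδ => ?_⟩
  obtain ⟨-, k, l, hsub, hmass⟩ := exists_cells M.wLaw (h := v / 4) (by linarith) a b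
  have hab' : M.wLaw.real {t : ℝ | (t : EReal) ∈ Set.uIoc a b} ≤ u := hab
  have h1 := hEA ω hω k l (by linarith) δ
  have h2 : M.partialGram a b ω δ ≤
      M.cellGram (outerCell M.wLaw (k * (v / 4)) (l * (v / 4))) ω δ := by
    rw [partialGram_eq_cellGram]; exact M.cellGram_mono hsub ω δ
  have h3 := l1norm_sq_le_of_mem_enlargedCone hS hδ
  have h4 : K * (Real.log p / n) * l1norm δ ^ 2 ≤
      K * (Real.log p / n) * (32 * s * ‖δ‖ ^ 2 + 2 * 0 ^ 2) :=
    mul_le_mul_of_nonneg_left h3 (by positivity)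
  have h5 : K * (Real.log p / n) * (32 * s * ‖δ‖ ^ 2 + 2 * 0 ^ 2) =
      32 * K * ‖δ‖ ^ 2 * (s * Real.log p / n) := by ring
  have h6 : 32 * K * ‖δ‖ ^ 2 * (s * Real.log p / n) ≤ 32 * K * ‖δ‖ ^ 2 * R :=
    mul_le_mul_of_nonneg_left (le_max_left _ _) (by positivity)
  have h7 : (2 * (m / r) * c + 32 * K) * ‖δ‖ ^ 2 * R =
      m / r * (2 * v) * ‖δ‖ ^ 2 + 32 * K * ‖δ‖ ^ 2 * R := by rw [hvdef]; ring
  linarith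

end ChangePointModel

end

/-! ### Choice of constants and assembly -/

theorem mainTheorem7 (κ φ : ℝ) (hκ : 0 < κ) (hκφ : κ ≤ φ) (C : ℝ≥0) (cA : ℝ) (hcA : 0 < cA) :
    ∃ c₀ > (0 : ℝ), ∃ c₁ > (0 : ℝ), ∃ c₂ > (0 : ℝ), ∃ c₃ > (0 : ℝ), ∃ c₄ > (0 : ℝ), ∃ c₅ > (0 : ℝ),
    ∃ c₆ > (0 : ℝ),
    ∀ (Ω : ℕ → Type*) [∀ n, MeasurableSpace (Ω n)]
      (P : ∀ n, Measure (Ω n)) [∀ n, IsProbabilityMeasure (P n)]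
      (p : ℕ → ℕ) (s l u v : ℕ → ℝ) (M : ∀ n, ChangePointModel n (p n) (Ω n)),
      (∀ᶠ n in atTop, n ≤ p n) →
      (∀ n, 1 ≤ s n) →
      (∀ n, ((M n).activeSet.card : ℝ) ≤ s n) →
      (∀ n, 0 < l n ∧ l n ≤ 1) →
      Tendsto (fun n => s n * Real.log (p n) / (n * l n ^ 2)) atTop (𝓝 0) →
      (∀ n, (M n).DistributionCondition (P n) κ φ C) →
      (∀ n, 0 ≤ u n) →
      (fun n => Real.log (u n)⁻¹) =O[atTop] (fun n => Real.log (p n)) →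
      (∀ n, 0 ≤ v n) →
      (∀ n, c₀ * (s n * Real.log (p n) / n) ≤ v n) →
      ∀ᶠ n in atTop, ∃ E : Set (Ω n), MeasurableSet E ∧
        1 - c₁ * Real.exp (-c₂ * Real.log (p n)) ≤ (P n).real E ∧
        ∀ ω ∈ E,
          (∀ a b : EReal, v n ≤ (M n).d a b → ∀ δ ∈ enlargedCone (M n).activeSet 0,
            c₃ * v n * ‖δ‖ ^ 2 ≤ (M n).partialGram a b ω δ) ∧
          (∀ a b : EReal, v n ≤ (M n).d a b →
            ∀ δ ∈ enlargedCone (M n).activeSet (cA * (M n).xiMax * Real.sqrt (s n)),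
            c₄ * v n * ‖δ‖ ^ 2 - c₅ * ((M n).xiMax ^ 2 * s n * Real.log (p n) / n)
              ≤ (M n).partialGram a b ω δ) ∧
          (∀ a b : EReal, (M n).d a b ≤ u n → ∀ δ ∈ enlargedCone (M n).activeSet 0,
            (M n).partialGram a b ω δ
              ≤ c₆ * ‖δ‖ ^ 2 * max (s n * Real.log (p n) / n) (u n)) := by
  obtain ⟨r, hr, m₀, hm₀, hmom⟩ := exists_lintegral_exp_sq_le C
  -- The second entry of the maximum forces θκ/2 ≤ 1/8, so that 1 - θκ/2 is a nonnegative moment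
  -- bound.
  set m := max m₀ (κ ^ 2 * r ^ 2) with hmdef
  have hm : 1 ≤ m := hm₀.le.trans (le_max_left _ _)
  set θ := κ * r ^ 2 / (4 * m) with hθdef
  have hθ : 0 < θ := by positivity
  have hθκ : θ * κ / 2 ≤ 1 := by
    have h1 : κ ^ 2 * r ^ 2 ≤ m := le_max_right _ _
    have h2 : θ * κ / 2 = κ ^ 2 * r ^ 2 / (8 * m) := by rw [hθdef]; field_simp; norm_num
    rw [h2, div_le_one (by positivity)]
    linarith
  set ρ := min 1 (θ * κ / 4) with hρdef
  have hρ : 0 < ρ := lt_min one_pos (by positivity)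
  have hρ1 : ρ ≤ 1 := min_le_left _ _
  have hρθ : ρ ≤ θ * κ / 4 := min_le_right _ _
  set K := 8 * (m / r) / ρ with hK
  have hK0 : 0 < K := by positivity
  -- The term 32/ρ makes nv large enough for the union bounds; 512K/κ lets the curvature absorb the
  -- cone error.
  set c := 32 / ρ + 512 * K / κ with hcdef
  have hc : 32 / ρ ≤ c := le_add_of_nonneg_right (by positivity)
  have hc' : 512 * K / κ ≤ c := le_add_of_nonneg_left (by positivity)
  have hc0 : 0 < c := by positivity
  refine ⟨c, hc0, 100, by norm_num, 1, one_pos, κ / 16, by positivity, κ / 16, by positivity,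
    2 * K * cA ^ 2, by positivity, 2 * (m / r) * c + 32 * K, by positivity, ?_⟩
  intro Ω _ P _ p s l u v M hnp hs hS _ _ hM _ _ _ hv
  filter_upwards [hnp, eventually_ge_atTop 2] with n hnp hn
  have hexp : ∀ i, ∀ z : EuclideanSpace ℝ (Fin (p n)), ‖z‖ = 1 →
      ∫⁻ ω, ENNReal.ofReal (Real.exp (r * (inner ℝ ((M n).x i ω) z : ℝ) ^ 2)) ∂(P n) ≤
        ENNReal.ofReal m := fun i z hz =>
    (hmom (Ω n) (P n) _ ((M n).measurable_inner_x i z) ((hM n).x_subgaussian i z hz)).trans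
      (ENNReal.ofReal_le_ofReal (le_max_left _ _))
  have hexp' : ∀ i, ∀ z : EuclideanSpace ℝ (Fin (p n)), ‖z‖ = 1 →
      ∫⁻ ω, ENNReal.ofReal (Real.exp (-θ * (inner ℝ ((M n).x i ω) z : ℝ) ^ 2)) ∂(P n) ≤
        ENNReal.ofReal (1 - θ * κ / 2) := fun i z hz =>
    lintegral_exp_neg_sq_le ((M n).measurable_inner_x i z) hr hm hκ (hexp i z hz)
      (((hM n).x_subgaussian i z hz).memLp 2).integrable_sq ((hM n).integral_inner_sq_ge i hz)
  obtain ⟨E, hE, hEP, hEA⟩ := exists_event_and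
    ((hM n).exists_event_le_partialGram hκ hn hnp hr hm hρ hρ1 hθ hθκ hρθ hexp hexp' (hs n) (hS n)
      hc hc' (hv n))
    ((hM n).exists_event_partialGram_le hn hnp hr hm hρ hρ1 hexp (u := u n) (hs n) (hS n) hc)
  refine ⟨E, hE, ?_, fun ω hω => ⟨fun a b hab δ hδ => ?_, fun a b hab δ hδ => ?_, (hEA ω hω).2⟩⟩
  · rw [probReal_compl_eq_one_sub hE] at hEP
    rw [neg_one_mul]
    linarith
  -- Parts (i) and (ii) are the same bound with enlargement 0 and c_A ξ_max √s.
  · have := (hEA ω hω).1 a b hab 0 δ hδ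
    simpa using this
  · have h := (hEA ω hω).1 a b hab _ δ hδ
    have hsq : Real.sqrt (s n) ^ 2 = s n := Real.sq_sqrt (by linarith [hs n])
    have e : 2 * K * (Real.log (p n) / n) * (cA * (M n).xiMax * Real.sqrt (s n)) ^ 2 =
        2 * K * cA ^ 2 * ((M n).xiMax ^ 2 * s n * Real.log (p n) / n) := by
      rw [mul_pow, mul_pow, hsq]; ring
    rw [e] at h
    exact h
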